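/- All surfaces are compact oriented topological $2$-manifolds, possibly with boundary and possibly disconnected. Fix $m,n\ge 0$. A doodle diagram $(\Sigma,D)$ with $n$ components consists of a surface $\Sigma$ and a continuous map $\gamma\colon\coprod_{i=1}^n S^1\to\Sigma$ with image $D$ (oriented by $\gamma$), such that the set of crossing points (points of $\Sigma$ with at least two preimages) is finite, no point of $\Sigma$ has more than $m$ preimages, and any two branches through a crossing point meet transversely, i.e. are the two coordinate axes in suitable local coordinates. (The usual choices are $m=2$, no triple points, and $m=3$, no more than three points with the same image.) Two doodle diagrams $(\Sigma_1,D_1)$, $(\Sigma_2,D_2)$ are geotopic if there are a surface $\Sigma_3$ and orientation-preserving embeddings $f_i\colon\Sigma_i\to\Sigma_3$, $i=1,2$, with $f_1(D_1)=f_2(D_2)$ as oriented curves, that is, as sets and, up to a permutation of the circles and orientation-preserving homeomorphisms of the circles, as parametrized curves. They are stably equivalent, $(\Sigma_1,D_1)\sim(\Sigma_2,D_2)$, if they are joined by a finite chain of doodle diagrams in which consecutive ones are geotopic. Surgery. Let $\gamma_1,\dots,\gamma_k$ be pairwise disjoint simple closed curves in $\Sigma\setminus(D\cup\partial\Sigma)$,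 and let $V_1,\dots,V_k$ be regular neighbourhoods of them (open annuli with core $\gamma_i$ whose two boundary circles have collars) with closures disjoint from each other, from $D$ and from $\partial\Sigma$. The surface $h^-(\Sigma)$ is obtained from $\Sigma\setminus\bigcup_i V_i$ by gluing $2k$ closed disks along their boundaries to the $2k$ new boundary circles; its orientation extends that of $\Sigma\setminus\bigcup_i V_i$. Handle addition. Let $\Gamma_1^+,\Gamma_1^-,\dots,\Gamma_k^+,\Gamma_k^-$ be pairwise disjoint closed disks, with collared boundary circles $\gamma_i^\pm=\partial\Gamma_i^\pm$, in $\Sigma\setminus(D\cup\partial\Sigma)$. The surface $h^+(\Sigma)$ is obtained from $\Sigma\setminus\bigcup_i \mathrm{Int}(\Gamma_i^+\cup\Gamma_i^-)$ by gluing $k$ handles $S^1\times[0,1]$, the ends of the $i$-th one being glued to $\gamma_i^+$ and $\gamma_i^-$ compatibly with the orientation of $\Sigma$; its orientation extends that of $\Sigma\setminus\bigcup_i \mathrm{Int}(\Gamma_i^+\cup\Gamma_i^-)$. **Theorem.** Let $(\Sigma,D)$ be a doodle diagram. For any choice of the data above, $h^-(\Sigma)$ and $h^+(\Sigma)$ are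 surfaces, $(h^-(\Sigma),D)$ and $(h^+(\Sigma),D)$ are doodle diagrams, and $$(h^-(\Sigma),D)\sim(\Sigma,D)\sim(h^+(\Sigma),D).$$ -/

import Mathlib

open Set Topology

universe u

namespace Doodle

/-! ### Oriented compact surfaces -/

/-- The closed upper half-plane, the local model of surfaces with boundary. -/
abbrev ClosedHalfPlane : Type := {z : ℂ // 0 ≤ z.im}

/-- Two local coordinates `a`, `b` around the point `x` of a surface (with values in the plane)
induce the same orientation at `x`: on a punctured neighbourhood of `x` the quotient
`(b y - b x) / (a y - a x)` has a continuous logarithm. Equivalently, the transition map `b ∘ a⁻¹`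
has local degree `1`: the image of a small positive loop around `a x` has winding number `1`
around `b x`. -/
def CoorientedAt {X : Type*} [TopologicalSpace X] (a b : X → ℂ) (x : X) : Prop :=
  ∃ U ∈ 𝓝 x, ∃ L : X → ℂ, ContinuousOn L (U \ {x}) ∧
    ∀ y ∈ U \ {x}, b y - b x = (a y - a x) * Complex.exp (L y)

/-- A surface: a compact Hausdorff topological 2-manifold, possibly with boundary and possibly
disconnected, with an orientation given by an atlas whose transition maps preserve the orientation
of the plane at interior points. -/
structure OrientedSurface where
  carrier : Type u
  [top : TopologicalSpace carrier]
  [t2 : T2Space carrier]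
  [compact : CompactSpace carrier]
  [charted : ChartedSpace ClosedHalfPlane carrier]
  oriented : ∀ e ∈ atlas ClosedHalfPlane carrier, ∀ e' ∈ atlas ClosedHalfPlane carrier,
    ∀ x ∈ e.source ∩ e'.source, 0 < (e x : ℂ).im → 0 < (e' x : ℂ).im →
      CoorientedAt (fun y => (e y : ℂ)) (fun y => (e' y : ℂ)) x

attribute [instance] OrientedSurface.top OrientedSurface.t2 OrientedSurface.compact
  OrientedSurface.charted

/-- The boundary of a surface: the points that no chart sends into the open half-plane. -/
def OrientedSurface.boundary (S : OrientedSurface.{u}) : Set S.carrier :=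
  {x | ∀ e ∈ atlas ClosedHalfPlane S.carrier, x ∈ e.source → (e x : ℂ).im = 0}

/-- A map of surfaces preserves orientation (at the interior points). -/
def PreservesOrientation (S T : OrientedSurface.{u}) (f : S.carrier → T.carrier) : Prop :=
  ∀ e ∈ atlas ClosedHalfPlane S.carrier, ∀ e' ∈ atlas ClosedHalfPlane T.carrier,
    ∀ x ∈ e.source, f x ∈ e'.source → 0 < (e x : ℂ).im → 0 < (e' (f x) : ℂ).im →
      CoorientedAt (fun y => (e y : ℂ)) (fun y => (e' (f y) : ℂ)) x

/-- The same for a map that is only defined on a subset `K` of the surface `S`; the condition is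
imposed at the interior points of `K`. -/
def PreservesOrientationOn (S T : OrientedSurface.{u}) (K : Set S.carrier)
    (f : K → T.carrier) : Prop :=
  ∀ e ∈ atlas ClosedHalfPlane S.carrier, ∀ e' ∈ atlas ClosedHalfPlane T.carrier,
    ∀ x : K, (x : S.carrier) ∈ interior K → (x : S.carrier) ∈ e.source → f x ∈ e'.source →
      0 < (e x : ℂ).im → 0 < (e' (f x) : ℂ).im →
        CoorientedAt (fun y : K => (e y : ℂ)) (fun y : K => (e' (f y) : ℂ)) x

/-- A parametrization `t` of an open subset of the surface `S` by an open subset of the plane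
preserves orientation. -/
def IsPositive (S : OrientedSurface.{u}) (t : OpenPartialHomeomorph ℂ S.carrier) : Prop :=
  ∀ e ∈ atlas ClosedHalfPlane S.carrier, ∀ z ∈ t.source, t z ∈ e.source →
    0 < (e (t z) : ℂ).im → CoorientedAt id (fun w => (e (t w) : ℂ)) z

/-! ### Doodle diagrams and stable equivalence -/

/-- The set of crossing points of a family of `n` closed curves. -/
def crossings {X : Type*} {n : ℕ} (γ : Fin n × Circle → X) : Set X :=
  {p | ∃ s t, s ≠ t ∧ γ s = p ∧ γ t = p}

/-- The branches of `γ` at the parameters `s` and `t` meet transversely: in suitable local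
coordinates around the common point they are the two coordinate axes. -/
def TransverseAt {X : Type*} [TopologicalSpace X] {n : ℕ} (γ : Fin n × Circle → X)
    (s t : Fin n × Circle) : Prop :=
  ∃ e : OpenPartialHomeomorph X ℂ, γ s ∈ e.source ∧
    (∀ᶠ q in 𝓝 s, (e (γ q)).im = 0) ∧ (∀ᶠ q in 𝓝 t, (e (γ q)).re = 0)

/-- An oriented doodle diagram with `n` components: a surface with `n` closed curves that have
finitely many crossing points, all of them transverse, and at most `m` points with the same image.
The subset `D` of the surface is `DoodleDiagram.image`; the curves orient it. -/
structure DoodleDiagram (m n : ℕ) where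
  surface : OrientedSurface.{u}
  curve : Fin n × Circle → surface.carrier
  continuous_curve : Continuous curve
  finite_crossings : (crossings curve).Finite
  multiplicity_le : ∀ p, (curve ⁻¹' {p}).encard ≤ m
  transverse : ∀ s t, s ≠ t → curve s = curve t → TransverseAt curve s t

variable {m n : ℕ}

/-- The underlying set `D` of a doodle diagram. -/
def DoodleDiagram.image (D : DoodleDiagram.{u} m n) : Set D.surface.carrier := range D.curve

/-- Two doodle diagrams are geotopic if their surfaces embed, preserving orientations, in a common
surface in such a way that the images of the two diagrams are the same oriented curves: the images
coincide as sets, and the parametrizations differ by a permutation of the circles and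
orientation-preserving homeomorphisms (that is, of degree `1`) of the circles. -/
def Geotopic (D E : DoodleDiagram.{u} m n) : Prop :=
  ∃ (S : OrientedSurface.{u}) (f : D.surface.carrier → S.carrier)
    (g : E.surface.carrier → S.carrier),
    IsEmbedding f ∧ PreservesOrientation D.surface S f ∧
    IsEmbedding g ∧ PreservesOrientation E.surface S g ∧
    f '' D.image = g '' E.image ∧
    ∃ (σ : Equiv.Perm (Fin n)) (h : Fin n → Circle ≃ₜ Circle),
      (∀ i, ∃ θ : C(Circle, ℝ), ∀ v, h i v = v * Circle.exp (θ v)) ∧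
      ∀ i v, f (D.curve (i, v)) = g (E.curve (σ i, h i v))

/-- Stable equivalence: a finite chain of geotopies. -/
def StablyEquivalent (D E : DoodleDiagram.{u} m n) : Prop :=
  Relation.TransGen Geotopic D E

/-- Let `Q` be a space obtained by gluing pieces to the part `K` of the surface of `D`, with
`ι : K → Q` the natural map. `E` is (a copy of) the resulting doodle diagram `(Q, D)`: its surface
is homeomorphic to `Q`, with an orientation that extends the given one on `K`, and its curves are
those of `D`. -/
def IsResult (D E : DoodleDiagram.{u} m n) (K : Set D.surface.carrier)
    {Q : Type u} [TopologicalSpace Q] (ι : K → Q) : Prop :=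
  ∃ φ : Q ≃ₜ E.surface.carrier,
    PreservesOrientationOn D.surface E.surface K (fun x => φ (ι x)) ∧
    ∀ s, ∃ hs : D.curve s ∈ K, E.curve s = φ (ι ⟨D.curve s, hs⟩)

/-! ### Surgery along simple closed curves -/

/-- Disjoint simple closed curves in the surface of `D` that meet neither `D` nor the boundary. -/
structure SurgeryCurves (D : DoodleDiagram.{u} m n) (k : ℕ) where
  curve : Fin k → Circle → D.surface.carrier
  continuous_curve : ∀ i, Continuous (curve i)
  injective_curve : ∀ i, Function.Injective (curve i)
  disjoint_curve : ∀ i j, i ≠ j → Disjoint (range (curve i)) (range (curve j))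
  disjoint_image : ∀ i, Disjoint (range (curve i)) D.image
  disjoint_boundary : ∀ i, Disjoint (range (curve i)) D.surface.boundary

/-- Regular neighbourhoods `V i` of the curves, with closures disjoint from each other, from `D`
and from the boundary. The neighbourhood `V i` is the image of the annulus `1/2 < |z| < 2`, the
curve being the image of the unit circle; the parametrization extends to an open annulus
`1/4 < |z| < 4`, which provides collars of the two boundary circles of `V i`. -/
structure RegularNeighborhoods {D : DoodleDiagram.{u} m n} {k : ℕ} (γ : SurgeryCurves D k) where
  tube : Fin k → OpenPartialHomeomorph ℂ D.surface.carrier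
  source_eq : ∀ i, (tube i).source = {z | 1 / 4 < ‖z‖ ∧ ‖z‖ < 4}
  positive : ∀ i, IsPositive D.surface (tube i)
  tube_circle : ∀ i (v : Circle), tube i v = γ.curve i v
  disjoint_target : ∀ i j, i ≠ j → Disjoint (tube i).target (tube j).target
  disjoint_image : ∀ i, Disjoint (tube i).target D.image
  disjoint_boundary : ∀ i, Disjoint (tube i).target D.surface.boundary

namespace RegularNeighborhoods

variable {D : DoodleDiagram.{u} m n} {k : ℕ} {γ : SurgeryCurves D k}

/-- The open neighbourhood of the `i`-th curve that is removed. -/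
def V (N : RegularNeighborhoods γ) (i : Fin k) : Set D.surface.carrier :=
  N.tube i '' {z | 1 / 2 < ‖z‖ ∧ ‖z‖ < 2}

/-- The surface with the neighbourhoods of the curves removed. -/
def K (N : RegularNeighborhoods γ) : Set D.surface.carrier := (⋃ i, N.V i)ᶜ

/-- `2k` closed disks. -/
abbrev Disks (k : ℕ) : Type := Fin k × Bool × Metric.closedBall (0 : ℂ) 1

/-- A boundary point `d` of a disk is glued to the point `2d` (resp. `d/2`) of the corresponding
boundary circle `|z| = 2` (resp. `|z| = 1/2`) of the `i`-th removed annulus. -/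
def glue (N : RegularNeighborhoods γ) (p q : N.K ⊕ Disks k) : Prop :=
  ∃ (x : N.K) (i : Fin k) (b : Bool) (d : Metric.closedBall (0 : ℂ) 1),
    p = Sum.inl x ∧ q = Sum.inr (i, b, d) ∧ ‖(d : ℂ)‖ = 1 ∧
      (x : D.surface.carrier) = N.tube i ((if b then 2 else 1 / 2) * (d : ℂ))

/-- The surgered surface `h⁻(Σ)`. -/
def surgery (N : RegularNeighborhoods γ) : Type u := Quot N.glue

instance (N : RegularNeighborhoods γ) : TopologicalSpace N.surgery :=
  inferInstanceAs (TopologicalSpace (Quot N.glue))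

/-- The natural map from the complement of the removed neighbourhoods to `h⁻(Σ)`. -/
def incl (N : RegularNeighborhoods γ) (x : N.K) : N.surgery := Quot.mk _ (Sum.inl x)

/-- `E` is the surgery `(h⁻(Σ), D)` of `D = (Σ, D)`. -/
def IsSurgery (N : RegularNeighborhoods γ) (E : DoodleDiagram.{u} m n) : Prop :=
  IsResult D E N.K N.incl

end RegularNeighborhoods

/-! ### Addition of handles -/

/-- `k` pairs of closed disks in the surface, disjoint from each other, from `D` and from the
boundary. Each disk is the image of the closed unit disk under a parametrization that extends to
the open disk of radius `2`; the paired curves `γᵢ⁺`, `γᵢ⁻` are the images of the unit circle. -/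
structure HandleDisks (D : DoodleDiagram.{u} m n) (k : ℕ) where
  disk : Fin k × Bool → OpenPartialHomeomorph ℂ D.surface.carrier
  source_eq : ∀ i, (disk i).source = Metric.ball 0 2
  positive : ∀ i, IsPositive D.surface (disk i)
  disjoint_target : ∀ i j, i ≠ j → Disjoint (disk i).target (disk j).target
  disjoint_image : ∀ i, Disjoint (disk i).target D.image
  disjoint_boundary : ∀ i, Disjoint (disk i).target D.surface.boundary

namespace HandleDisks

variable {D : DoodleDiagram.{u} m n} {k : ℕ}

/-- The surface with the interiors of the disks removed. -/
def K (H : HandleDisks D k) : Set D.surface.carrier :=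
  (⋃ i, H.disk i '' Metric.ball 0 1)ᶜ

/-- `k` copies of the handle `S¹ × [0, 1]`. -/
abbrev Handles (k : ℕ) : Type := Fin k × Circle × unitInterval

/-- The end `S¹ × {1}` of the `i`-th handle is glued to `γᵢ⁺` by `v ↦ v` and the end `S¹ × {0}` is
glued to `γᵢ⁻` by `v ↦ v⁻¹`. As both disks are parametrized positively, the change of sense at one
of the ends makes the gluing compatible with the orientation. -/
def glue (H : HandleDisks D k) (p q : H.K ⊕ Handles k) : Prop :=
  ∃ (x : H.K) (i : Fin k) (v : Circle), p = Sum.inl x ∧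
    ((q = Sum.inr (i, v, 1) ∧ (x : D.surface.carrier) = H.disk (i, true) (v : ℂ)) ∨
     (q = Sum.inr (i, v, 0) ∧ (x : D.surface.carrier) = H.disk (i, false) ((v⁻¹ : Circle) : ℂ)))

/-- The surface `h⁺(Σ)` with handles added. -/
def addition (H : HandleDisks D k) : Type u := Quot H.glue

instance (H : HandleDisks D k) : TopologicalSpace H.addition :=
  inferInstanceAs (TopologicalSpace (Quot H.glue))

/-- The natural map from the complement of the interiors of the disks to `h⁺(Σ)`. -/
def incl (H : HandleDisks D k) (x : H.K) : H.addition := Quot.mk _ (Sum.inl x)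

/-- `E` is the diagram `(h⁺(Σ), D)` obtained from `D = (Σ, D)` by the addition of handles. -/
def IsHandleAddition (H : HandleDisks D k) (E : DoodleDiagram.{u} m n) : Prop :=
  IsResult D E H.K H.incl

end HandleDisks

end Doodle

/-! Let `K` be the part of the surface that the operation leaves untouched. It is itself a compact
surface, with additional boundary circles, and it contains the diagram away from these circles. It
embeds, preserving orientation and carrying the curves to the same curves, both in the original
surface and in the result of the gluing. Such an embedding gives geotopies in both directions, with
the larger surface as common surface (`geotopic_of_isEmbedding`). So the diagram on `K` joins the
other two by a chain of two geotopies: `CollaredPart.stablyEquivalent_of_isResult`.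

The work lies in showing that `K` and the glued space are oriented surfaces. In both cases
`SurfacePieces` assembles an atlas from the charts of the original surface, restricted to `K`
without the new circles, and extra charts at the remaining points. For `K` the extra charts are
branches of the logarithm of the collar coordinate, which straighten the circle to the real axis.
For the glued space each disk or handle, together with the collars at its rim, has one continuous
injective coordinate onto an open set of the plane: a disk for a cap, an annulus for a handle.
Compactness, not invariance of domain, makes it a chart (`chartOfCompacts`). All these coordinates
are holomorphic functions, with nonzero derivative, of positive collar coordinates, hence compatible
with the orientation.

Surgery and handle addition differ only in their data: each gives a `CollaredPart` and a `Filling`,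
and `Filling.exists_isResult` produces the new diagram. -/

namespace Doodle

/-! ### Calculus of coorientation -/

section Coorientation

variable {X Y : Type*} [TopologicalSpace X] [TopologicalSpace Y]

theorem CoorientedAt.refl (a : X → ℂ) (x : X) : CoorientedAt a a x :=
  ⟨univ, Filter.univ_mem, fun _ => 0, continuousOn_const, fun y _ => by simp⟩

theorem CoorientedAt.symm {a b : X → ℂ} {x : X} (h : CoorientedAt a b x) : CoorientedAt b a x := by
  obtain ⟨U, hU, L, hL, h⟩ := h
  refine ⟨U, hU, fun y => -L y, hL.neg, fun y hy => ?_⟩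
  rw [h y hy, mul_assoc, ← Complex.exp_add, add_neg_cancel, Complex.exp_zero, mul_one]

theorem CoorientedAt.trans {a b c : X → ℂ} {x : X} (h : CoorientedAt a b x)
    (h' : CoorientedAt b c x) : CoorientedAt a c x := by
  obtain ⟨U, hU, L, hL, h⟩ := h
  obtain ⟨V, hV, M, hM, h'⟩ := h'
  refine ⟨U ∩ V, Filter.inter_mem hU hV, fun y => L y + M y,
    (hL.mono fun y hy => ⟨hy.1.1, hy.2⟩).add (hM.mono fun y hy => ⟨hy.1.2, hy.2⟩), fun y hy => ?_⟩
  rw [h' y ⟨hy.1.2, hy.2⟩, h y ⟨hy.1.1, hy.2⟩, mul_assoc, ← Complex.exp_add]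

theorem CoorientedAt.congr {a b a' b' : X → ℂ} {x : X} (h : CoorientedAt a b x)
    (ha : a' =ᶠ[𝓝 x] a) (hb : b' =ᶠ[𝓝 x] b) : CoorientedAt a' b' x := by
  obtain ⟨U, hU, L, hL, h⟩ := h
  refine ⟨U ∩ {y | a' y = a y ∧ b' y = b y}, Filter.inter_mem hU (ha.and hb), L,
    hL.mono fun y hy => ⟨hy.1.1, hy.2⟩, fun y hy => ?_⟩
  rw [ha.self_of_nhds, hb.self_of_nhds, hy.1.2.1, hy.1.2.2, h y ⟨hy.1.1, hy.2⟩]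

theorem CoorientedAt.comp {a b : X → ℂ} {y : Y} (φ : OpenPartialHomeomorph Y X)
    (hy : y ∈ φ.source) (h : CoorientedAt a b (φ y)) :
    CoorientedAt (fun z => a (φ z)) (fun z => b (φ z)) y := by
  obtain ⟨U, hU, L, hL, h⟩ := h
  have key : ∀ z ∈ (φ.source ∩ φ ⁻¹' U) \ {y}, φ z ∈ U \ {φ y} := fun z hz =>
    ⟨hz.1.2, fun e => hz.2 (φ.injOn hz.1.1 hy e)⟩
  exact ⟨φ.source ∩ φ ⁻¹' U,
    Filter.inter_mem (φ.open_source.mem_nhds hy) (φ.continuousAt hy hU), fun z => L (φ z),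
    hL.comp (φ.continuousOn.mono fun z hz => hz.1.1) key, fun z hz => h _ (key z hz)⟩

theorem CoorientedAt.of_comp {a b : X → ℂ} {y : Y} (φ : OpenPartialHomeomorph Y X)
    (hy : y ∈ φ.source) (h : CoorientedAt (fun z => a (φ z)) (fun z => b (φ z)) y) :
    CoorientedAt a b (φ y) := by
  have hφ : ∀ᶠ x in 𝓝 (φ y), φ (φ.symm x) = x :=
    φ.eventually_right_inverse (φ.map_source hy)
  have h' := CoorientedAt.comp (y := φ y) φ.symm (φ.map_source hy) (by rwa [φ.left_inv hy])
  exact h'.congr (hφ.mono fun x hx => by simp only [hx]) (hφ.mono fun x hx => by simp only [hx])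

/-- Coorientation is a local condition, so it can be tested on any open subspace. This transports
orientations between a surface, its open part and the space in which that part is embedded. -/
theorem coorientedAt_comp_iff {a b : X → ℂ} {i : Y → X} (hi : IsOpenEmbedding i) (y : Y) :
    CoorientedAt (fun z => a (i z)) (fun z => b (i z)) y ↔ CoorientedAt a b (i y) := by
  have : Nonempty Y := ⟨y⟩
  exact ⟨CoorientedAt.of_comp (hi.toOpenPartialHomeomorph i) (mem_univ y),
    CoorientedAt.comp (hi.toOpenPartialHomeomorph i) (mem_univ y)⟩

/-- Near `z` the difference quotient divided by `f'` is close to `1`, hence in the slit plane, where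
the principal logarithm is continuous; adding `log f'` gives the required logarithm. Continuity of
`f` near `z` makes the quotient continuous off `z`. -/
theorem coorientedAt_of_hasDerivAt {f : ℂ → ℂ} {z f' : ℂ} (hf : HasDerivAt f f' z) (hf' : f' ≠ 0)
    (hc : ∀ᶠ w in 𝓝 z, ContinuousAt f w) : CoorientedAt id f z := by
  have h1 : Filter.Tendsto (fun w => slope f z w / f') (𝓝[≠] z) (𝓝 1) := by
    have := hf.tendsto_slope.div_const f'
    rwa [div_self hf'] at this
  have h2 := h1 (Complex.isOpen_slitPlane.mem_nhds Complex.one_mem_slitPlane)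
  rw [Filter.mem_map, mem_nhdsWithin_iff_eventually] at h2
  refine ⟨{w | ContinuousAt f w ∧ (w ∈ ({z}ᶜ : Set ℂ) → slope f z w / f' ∈ Complex.slitPlane)},
    hc.and h2, fun w => Complex.log (slope f z w / f') + Complex.log f', ?_, ?_⟩
  · rintro w ⟨⟨hw, hs⟩, hne⟩
    have hne' : w - z ≠ 0 := sub_ne_zero.2 hne
    refine ContinuousAt.continuousWithinAt ?_
    refine ContinuousAt.add (ContinuousAt.clog ?_ (hs hne)) continuousAt_const
    simp only [slope_def_field]
    exact ((hw.sub continuousAt_const).div (by fun_prop) hne').div_const _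
  · rintro w ⟨⟨hw, hs⟩, hne⟩
    have hne' : w - z ≠ 0 := sub_ne_zero.2 hne
    rw [Complex.exp_add, Complex.exp_log (Complex.slitPlane_ne_zero (hs hne)), Complex.exp_log hf',
      slope_def_field]
    simp only [id]
    field_simp

end Coorientation

/-! ### Oriented surfaces assembled from an open part and further charts -/

section Pieces

variable (S : OrientedSurface.{u})

theorem OrientedSurface.exists_positive_chart {x : S.carrier} (hx : x ∉ S.boundary) :
    ∃ e ∈ atlas ClosedHalfPlane S.carrier, x ∈ e.source ∧ 0 < (e x : ℂ).im := by
  simp only [OrientedSurface.boundary, mem_ofPred_eq, not_forall] at hx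
  obtain ⟨e, he, hxe, h⟩ := hx
  exact ⟨e, he, hxe, lt_of_le_of_ne (e x).2 (Ne.symm h)⟩

variable {S} {X : Type u} [TopologicalSpace X] {O : TopologicalSpace.Opens S.carrier} {j : O → X}

/-- A chart of `S`, restricted to `O` and transported along the open embedding `j : O → X`. -/
noncomputable def liftChart (hj : IsOpenEmbedding j) (hO : Nonempty O)
    (e : OpenPartialHomeomorph S.carrier ClosedHalfPlane) :
    OpenPartialHomeomorph X ClosedHalfPlane :=
  haveI : Nonempty ClosedHalfPlane := ⟨⟨0, le_rfl⟩⟩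
  (e.subtypeRestr hO).lift_openEmbedding hj

theorem liftChart_source (hj : IsOpenEmbedding j) (hO : Nonempty O)
    (e : OpenPartialHomeomorph S.carrier ClosedHalfPlane) :
    (liftChart hj hO e).source = j '' {o | (o : S.carrier) ∈ e.source} := by
  simp only [liftChart, OpenPartialHomeomorph.lift_openEmbedding_source,
    OpenPartialHomeomorph.subtypeRestr_source]
  rfl

theorem liftChart_apply (hj : IsOpenEmbedding j) (hO : Nonempty O)
    (e : OpenPartialHomeomorph S.carrier ClosedHalfPlane) (o : O) :
    liftChart hj hO e (j o) = e o := by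
  have : Nonempty ClosedHalfPlane := ⟨⟨0, le_rfl⟩⟩
  exact (OpenPartialHomeomorph.lift_openEmbedding_apply _ hj).trans rfl

/-- The chart `a` of `X` is positive at the points of `j '' O` that it sends to the open
half-plane. -/
def IsPositiveChart (j : O → X) (a : OpenPartialHomeomorph X ClosedHalfPlane) : Prop :=
  ∀ o : O, j o ∈ a.source → 0 < (a (j o) : ℂ).im →
    ∃ e ∈ atlas ClosedHalfPlane S.carrier, (o : S.carrier) ∈ e.source ∧ 0 < (e o : ℂ).im ∧
      CoorientedAt (fun p : O => (e p : ℂ)) (fun p : O => (a (j p) : ℂ)) o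

variable (S) in
/-- An open subset `O` of a surface, embedded in `X`, and further charts of `X` that are compatible
with it, covering together `X`. -/
structure SurfacePieces (O : TopologicalSpace.Opens S.carrier) (j : O → X) where
  isOpenEmbedding : IsOpenEmbedding j
  charts : Set (OpenPartialHomeomorph X ClosedHalfPlane)
  cover : ∀ x, x ∉ range j → ∃ a ∈ charts, x ∈ a.source
  positive : ∀ a ∈ charts, IsPositiveChart j a
  compatible : ∀ a ∈ charts, ∀ b ∈ charts, ∀ x ∉ range j, x ∈ a.source → x ∈ b.source →
    0 < (a x : ℂ).im → 0 < (b x : ℂ).im →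
      CoorientedAt (fun y => (a y : ℂ)) (fun y => (b y : ℂ)) x

namespace SurfacePieces

variable (P : SurfacePieces S O j)

/-- The atlas obtained from the charts of the pieces. -/
def fullAtlas : Set (OpenPartialHomeomorph X ClosedHalfPlane) :=
  {a | ∃ hO : Nonempty O, ∃ e ∈ atlas ClosedHalfPlane S.carrier,
    a = liftChart P.isOpenEmbedding hO e} ∪ P.charts

theorem fullAtlas_cover (x : X) : ∃ a ∈ P.fullAtlas, x ∈ a.source := by
  by_cases hx : x ∈ range j
  · obtain ⟨o, rfl⟩ := hx
    refine ⟨_, Or.inl ⟨⟨o⟩, chartAt ClosedHalfPlane (o : S.carrier), chart_mem_atlas _ _, rfl⟩, ?_⟩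
    rw [liftChart_source]
    exact ⟨o, mem_chart_source _ _, rfl⟩
  · obtain ⟨a, ha, hxa⟩ := P.cover x hx
    exact ⟨a, Or.inr ha, hxa⟩

theorem isPositiveChart {a : OpenPartialHomeomorph X ClosedHalfPlane} (ha : a ∈ P.fullAtlas) :
    IsPositiveChart j a := by
  rcases ha with ⟨hO, e, he, rfl⟩ | ha
  · intro o ho hpos
    rw [liftChart_source] at ho
    obtain ⟨o', ho', h⟩ := ho
    obtain rfl := P.isOpenEmbedding.injective h
    rw [liftChart_apply] at hpos
    refine ⟨e, he, ho', hpos, ?_⟩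
    simp only [liftChart_apply]
    exact CoorientedAt.refl _ _
  · exact P.positive a ha

/-- The charted space structure of the union of the pieces. -/
@[reducible] noncomputable def chartedSpace : ChartedSpace ClosedHalfPlane X where
  atlas := P.fullAtlas
  chartAt x := (P.fullAtlas_cover x).choose
  mem_chart_source x := (P.fullAtlas_cover x).choose_spec.2
  chart_mem_atlas x := (P.fullAtlas_cover x).choose_spec.1

/-- Over the open part both charts are compared with charts of `S`, whose orientation then links
them. Elsewhere no lifted chart is present, and the compatibility of the extra charts applies. -/
theorem coorientedAt_fullAtlas {a b : OpenPartialHomeomorph X ClosedHalfPlane}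
    (ha : a ∈ P.fullAtlas) (hb : b ∈ P.fullAtlas) {x : X} (hxa : x ∈ a.source)
    (hxb : x ∈ b.source) (ha0 : 0 < (a x : ℂ).im) (hb0 : 0 < (b x : ℂ).im) :
    CoorientedAt (fun y => (a y : ℂ)) (fun y => (b y : ℂ)) x := by
  by_cases hx : x ∈ range j
  · obtain ⟨o, rfl⟩ := hx
    obtain ⟨e, he, hoe, he0, h⟩ := P.isPositiveChart ha o hxa ha0
    obtain ⟨e', he', hoe', he0', h'⟩ := P.isPositiveChart hb o hxb hb0
    have h1 := (coorientedAt_comp_iff O.2.isOpenEmbedding_subtypeVal o).2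
      (S.oriented e he e' he' o ⟨hoe, hoe'⟩ he0 he0')
    exact (coorientedAt_comp_iff (a := fun y => (a y : ℂ)) (b := fun y => (b y : ℂ))
      P.isOpenEmbedding o).1 ((h.symm.trans h1).trans h')
  · have key : ∀ {c : OpenPartialHomeomorph X ClosedHalfPlane}, c ∈ P.fullAtlas → x ∈ c.source →
        c ∈ P.charts := by
      rintro c (⟨hO, e, he, rfl⟩ | hc) hxc
      · rw [liftChart_source] at hxc
        exact absurd (image_subset_range _ _ hxc) hx
      · exact hc
    exact P.compatible a (key ha hxa) b (key hb hxb) x hx hxa hxb ha0 hb0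

/-- `IsPositiveChart` provides only some chart of `S`; the orientation of `S` replaces it by any
prescribed one. This shows that the orientation of the new surface extends the old one. -/
theorem coorientedAt_inner {e : OpenPartialHomeomorph S.carrier ClosedHalfPlane}
    (he : e ∈ atlas ClosedHalfPlane S.carrier) {a : OpenPartialHomeomorph X ClosedHalfPlane}
    (ha : a ∈ P.fullAtlas) (o : O) (hoe : (o : S.carrier) ∈ e.source) (hoa : j o ∈ a.source)
    (he0 : 0 < (e o : ℂ).im) (ha0 : 0 < (a (j o) : ℂ).im) :
    CoorientedAt (fun p : O => (e p : ℂ)) (fun p : O => (a (j p) : ℂ)) o := by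
  obtain ⟨e', he', hoe', he0', h⟩ := P.isPositiveChart ha o hoa ha0
  exact ((coorientedAt_comp_iff O.2.isOpenEmbedding_subtypeVal o).2
      (S.oriented e he e' he' o ⟨hoe, hoe'⟩ he0 he0')).trans h

variable [T2Space X] [CompactSpace X]

/-- The oriented surface obtained from the pieces. -/
noncomputable def toSurface : OrientedSurface.{u} :=
  letI := P.chartedSpace
  { carrier := X
    oriented := fun _ he _ he' _ hx h h' => P.coorientedAt_fullAtlas he he' hx.1 hx.2 h h' }

end SurfacePieces

end Pieces

/-! ### Transport of diagrams along embeddings -/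

section Diagrams

variable {m n : ℕ}

theorem transverseAt_comp {X Y : Type*} [TopologicalSpace X] [TopologicalSpace Y]
    {γ : Fin n × Circle → X} {s t : Fin n × Circle} (h : TransverseAt γ s t)
    (O : TopologicalSpace.Opens X) (hγ : ∀ q, γ q ∈ O) {j : O → Y} (hj : IsOpenEmbedding j) :
    TransverseAt (fun q => j ⟨γ q, hγ q⟩) s t := by
  obtain ⟨e, he, h1, h2⟩ := h
  have key : ∀ q, (e.subtypeRestr ⟨⟨γ s, hγ s⟩⟩).lift_openEmbedding hj (j ⟨γ q, hγ q⟩) = e (γ q) :=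
    fun q => (OpenPartialHomeomorph.lift_openEmbedding_apply _ hj).trans rfl
  refine ⟨(e.subtypeRestr ⟨⟨γ s, hγ s⟩⟩).lift_openEmbedding hj, ?_, ?_, ?_⟩
  · rw [OpenPartialHomeomorph.lift_openEmbedding_source, OpenPartialHomeomorph.subtypeRestr_source]
    exact ⟨_, he, rfl⟩
  · simpa only [key] using h1
  · simpa only [key] using h2

/-- The doodle diagram with the curves of `D`, on a surface in which a neighbourhood of `D` is
embedded. -/
def DoodleDiagram.push (D : DoodleDiagram.{u} m n) (T : OrientedSurface.{u})
    (O : TopologicalSpace.Opens D.surface.carrier) (hD : ∀ q, D.curve q ∈ O) {j : O → T.carrier}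
    (hj : IsOpenEmbedding j) : DoodleDiagram.{u} m n where
  surface := T
  curve q := j ⟨D.curve q, hD q⟩
  continuous_curve := hj.continuous.comp (D.continuous_curve.subtype_mk _)
  finite_crossings := by
    refine ((D.finite_crossings.preimage (Subtype.val_injective.injOn (s := univ) |>.mono
      (subset_univ _))).image j).subset ?_
    rintro p ⟨s, t, hst, rfl, h⟩
    exact ⟨_, ⟨s, t, hst, rfl, congrArg Subtype.val (hj.injective h)⟩, rfl⟩
  multiplicity_le p := by
    by_cases hp : p ∈ range j
    · obtain ⟨o, rfl⟩ := hp
      refine le_trans (encard_le_encard ?_) (D.multiplicity_le o)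
      intro q hq
      exact congrArg Subtype.val (hj.injective hq)
    · have : (fun q => j ⟨D.curve q, hD q⟩) ⁻¹' {p} = ∅ :=
        eq_empty_of_forall_notMem fun q hq => hp ⟨_, hq⟩
      rw [this, encard_empty]
      exact zero_le
  transverse s t hst h := transverseAt_comp
    (D.transverse s t hst (congrArg Subtype.val (hj.injective h))) O hD hj

/-- The surface of `E` serves as the common surface, with `f` and the identity as the two
embeddings. -/
theorem geotopic_of_isEmbedding {D E : DoodleDiagram.{u} m n}
    {f : D.surface.carrier → E.surface.carrier} (hf : IsEmbedding f)
    (ho : PreservesOrientation D.surface E.surface f) (h : ∀ s, f (D.curve s) = E.curve s) :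
    Geotopic D E ∧ Geotopic E D := by
  have hid : PreservesOrientation E.surface E.surface id := fun e he e' he' x hx hx' h h' =>
    E.surface.oriented e he e' he' x ⟨hx, hx'⟩ h h'
  have him : f '' D.image = id '' E.image := by
    rw [image_id, DoodleDiagram.image, DoodleDiagram.image, ← range_comp]
    exact congrArg range (funext h)
  have hθ : ∀ v : Circle, Homeomorph.refl Circle v = v * Circle.exp ((0 : C(Circle, ℝ)) v) := by
    simp
  refine ⟨⟨E.surface, f, id, hf, ho, .id, hid, him, 1, fun _ => .refl _, fun _ => ⟨0, hθ⟩, ?_⟩,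
    ⟨E.surface, id, f, .id, hid, hf, ho, him.symm, 1, fun _ => .refl _, fun _ => ⟨0, hθ⟩, ?_⟩⟩
  · exact fun i v => h (i, v)
  · exact fun i v => (h (i, v)).symm

end Diagrams

/-! ### Half-plane charts from plane charts -/

section HalfPlane

/-- The point of the closed half-plane above or below which `z` lies, at the same height up to
sign. -/
noncomputable def foldHalfPlane (z : ℂ) : ClosedHalfPlane :=
  ⟨⟨z.re, |z.im|⟩, abs_nonneg _⟩

theorem foldHalfPlane_of_nonneg {z : ℂ} (hz : 0 ≤ z.im) : (foldHalfPlane z : ℂ) = z :=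
  Complex.ext rfl (abs_of_nonneg hz)

theorem continuous_foldHalfPlane : Continuous foldHalfPlane := by
  refine Continuous.subtype_mk ?_ _
  have : (fun z : ℂ => (⟨z.re, |z.im|⟩ : ℂ)) = fun z => (z.re : ℂ) + (|z.im| : ℝ) * Complex.I := by
    funext z
    apply Complex.ext <;> simp
  rw [this]
  fun_prop

/-- A chart in the half-plane, obtained from a chart in the plane by restriction to an embedded
space that corresponds to the half-plane. -/
noncomputable def halfPlaneChart {X Y : Type*} [TopologicalSpace X] [TopologicalSpace Y]
    [Nonempty Y] {i : Y → X} (hi : IsEmbedding i) (e : OpenPartialHomeomorph X ℂ)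
    (h : ∀ x ∈ e.source, x ∈ range i ↔ 0 ≤ (e x).im) :
    OpenPartialHomeomorph Y ClosedHalfPlane where
  toFun y := foldHalfPlane (e (i y))
  invFun z := Function.invFun i (e.symm z)
  source := i ⁻¹' e.source
  target := Subtype.val ⁻¹' e.target
  map_source' y hy := by
    have := foldHalfPlane_of_nonneg ((h _ hy).1 (mem_range_self y))
    simp only [mem_preimage, this]
    exact e.map_source hy
  map_target' z hz := by
    have hz' : e.symm z ∈ range i :=
      (h _ (e.map_target hz)).2 (by rw [e.right_inv hz]; exact z.2)
    simp only [mem_preimage, Function.invFun_eq hz']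
    exact e.map_target hz
  left_inv' y hy := by
    rw [foldHalfPlane_of_nonneg ((h _ hy).1 (mem_range_self y)), e.left_inv hy,
      Function.leftInverse_invFun hi.injective y]
  right_inv' z hz := by
    have hz' : e.symm z ∈ range i :=
      (h _ (e.map_target hz)).2 (by rw [e.right_inv hz]; exact z.2)
    apply Subtype.ext
    rw [Function.invFun_eq hz', e.right_inv hz, foldHalfPlane_of_nonneg z.2]
  open_source := e.open_source.preimage hi.continuous
  open_target := e.open_target.preimage continuous_subtype_val
  continuousOn_toFun := continuous_foldHalfPlane.comp_continuousOn
    (e.continuousOn.comp hi.continuous.continuousOn fun _ hy => hy)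
  continuousOn_invFun := by
    rw [hi.continuousOn_iff]
    refine (e.continuousOn_symm.comp continuous_subtype_val.continuousOn fun _ hz => hz).congr ?_
    intro z hz
    exact Function.invFun_eq
      ((h _ (e.map_target hz)).2 (by rw [e.right_inv hz]; exact z.2))

theorem halfPlaneChart_apply {X Y : Type*} [TopologicalSpace X] [TopologicalSpace Y]
    [Nonempty Y] {i : Y → X} (hi : IsEmbedding i) (e : OpenPartialHomeomorph X ℂ)
    (h : ∀ x ∈ e.source, x ∈ range i ↔ 0 ≤ (e x).im) {y : Y} (hy : i y ∈ e.source) :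
    (halfPlaneChart hi e h y : ℂ) = e (i y) :=
  foldHalfPlane_of_nonneg ((h _ hy).1 (mem_range_self y))

end HalfPlane

/-! ### The untouched part as a surface with boundary -/

/-- A part `K` of a surface, bounded by finitely many circles with collars. In the annulus
parametrized by `collar j`, the part `K` is given by `1 ≤ ‖w‖`. -/
structure CollaredPart (S : OrientedSurface.{u}) (J : Type) where
  K : Set S.carrier
  isClosed_K : IsClosed K
  collar : J → OpenPartialHomeomorph ℂ S.carrier
  source_eq : ∀ j, (collar j).source = {w | 1 / 2 < ‖w‖ ∧ ‖w‖ < 2}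
  positive : ∀ j, IsPositive S (collar j)
  disjoint_target : ∀ i j, i ≠ j → Disjoint (collar i).target (collar j).target
  disjoint_boundary : ∀ j, Disjoint (collar j).target S.boundary
  mem_K_iff : ∀ j, ∀ w ∈ (collar j).source, collar j w ∈ K ↔ 1 ≤ ‖w‖
  isOpen_diff : IsOpen (K \ ⋃ j, collar j '' Metric.sphere 0 1)

namespace CollaredPart

variable {S : OrientedSurface.{u}} {J : Type} (C : CollaredPart S J)

theorem mem_source {j : J} {w : ℂ} : w ∈ (C.collar j).source ↔ 1 / 2 < ‖w‖ ∧ ‖w‖ < 2 := by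
  rw [C.source_eq]; rfl

theorem sphere_subset_source (j : J) : Metric.sphere (0 : ℂ) 1 ⊆ (C.collar j).source := by
  intro w hw
  rw [mem_sphere_zero_iff_norm] at hw
  rw [C.mem_source, hw]
  norm_num

theorem collar_inj {i j : J} {v w : ℂ} (hv : v ∈ (C.collar i).source)
    (hw : w ∈ (C.collar j).source) (h : C.collar i v = C.collar j w) : i = j ∧ v = w := by
  have hij : i = j := by
    by_contra hij
    exact (C.disjoint_target i j hij).ne_of_mem ((C.collar i).map_source hv)
      ((C.collar j).map_source hw) h
  subst hij
  exact ⟨rfl, (C.collar i).injOn hv hw h⟩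

/-- The part `K` without the circles that bound it. -/
def inner : TopologicalSpace.Opens S.carrier := ⟨_, C.isOpen_diff⟩

theorem inner_subset : (C.inner : Set S.carrier) ⊆ C.K := sdiff_subset

theorem mem_inner {x : S.carrier} :
    x ∈ C.inner ↔ x ∈ C.K ∧ ∀ j, x ∉ C.collar j '' Metric.sphere 0 1 := by
  change x ∈ C.K \ _ ↔ _
  simp only [mem_sdiff, mem_iUnion, not_exists]

theorem collar_mem_inner {j : J} {w : ℂ} (hw : w ∈ (C.collar j).source) :
    C.collar j w ∈ C.inner ↔ 1 < ‖w‖ := by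
  rw [C.mem_inner, C.mem_K_iff j w hw]
  constructor
  · rintro ⟨h, h'⟩
    refine lt_of_le_of_ne h fun h1 => h' j ⟨w, ?_, rfl⟩
    rw [mem_sphere_zero_iff_norm, h1]
  · refine fun h => ⟨h.le, fun i => ?_⟩
    rintro ⟨v, hv, hvw⟩
    obtain ⟨-, rfl⟩ := C.collar_inj (C.sphere_subset_source i hv) hw hvw
    rw [mem_sphere_zero_iff_norm] at hv
    exact h.ne' hv

/-- The embedding of the inner part in `K`. -/
def innerToK : C.inner → C.K := inclusion C.inner_subset

theorem isOpenEmbedding_innerToK : IsOpenEmbedding C.innerToK := by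
  refine ⟨IsEmbedding.inclusion C.inner_subset, ?_⟩
  rw [innerToK, range_inclusion]
  exact C.inner.2.preimage continuous_subtype_val

theorem mem_range_innerToK {x : C.K} : x ∈ range C.innerToK ↔ (x : S.carrier) ∈ C.inner := by
  rw [innerToK, range_inclusion]; rfl

/-- A point of a bounding circle is a limit of collar points with `‖w‖ < 1`, which lie outside `K`.
-/
theorem interior_K_subset : interior C.K ⊆ C.inner := by
  intro x hx
  refine C.mem_inner.2 ⟨interior_subset hx, ?_⟩
  rintro j ⟨w, hw, rfl⟩
  have hws := C.sphere_subset_source j hw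
  rw [mem_sphere_zero_iff_norm] at hw
  have h1 : ∀ᶠ v in 𝓝 w, C.collar j v ∈ C.K ∧ v ∈ (C.collar j).source :=
    Filter.Eventually.and ((C.collar j).continuousAt hws (mem_interior_iff_mem_nhds.1 hx))
      ((C.collar j).open_source.mem_nhds hws)
  have h2 : w ∈ closure (Metric.ball (0 : ℂ) 1) := by
    rw [closure_ball _ one_ne_zero, mem_closedBall_zero_iff, hw]
  obtain ⟨v, hv, hvK, hvs⟩ := (mem_closure_iff_frequently.1 h2 |>.and_eventually h1).exists
  rw [mem_ball_zero_iff] at hv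
  exact hv.not_ge ((C.mem_K_iff j v hvs).1 hvK)

theorem inner_subset_interior : (C.inner : Set S.carrier) ⊆ interior C.K :=
  C.inner.2.subset_interior_iff.2 C.inner_subset

/-- Charts of a space in which the inner part is embedded are positive if they are holomorphic in
the coordinates of the collars. -/
theorem isPositiveChart {X : Type u} [TopologicalSpace X] {j : C.inner → X}
    (a : OpenPartialHomeomorph X ClosedHalfPlane)
    (h : ∀ o, j o ∈ a.source → ∃ i, ∃ w ∈ (C.collar i).source, C.collar i w = o ∧
      ∃ (f : ℂ → ℂ) (f' : ℂ), HasDerivAt f f' w ∧ f' ≠ 0 ∧ (∀ᶠ v in 𝓝 w, ContinuousAt f v) ∧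
        ∀ᶠ p in 𝓝 o, (a (j p) : ℂ) = f ((C.collar i).symm p)) :
    IsPositiveChart j a := by
  rintro ⟨x, hx⟩ ho -
  obtain ⟨i, w, hw, rfl, f, f', hf, hf', hc, hev⟩ := h _ ho
  have ht := (C.collar i).map_source hw
  obtain ⟨e, he, hxe, h0⟩ := S.exists_positive_chart
    ((C.disjoint_boundary i).notMem_of_mem_left ht)
  refine ⟨e, he, hxe, h0, ?_⟩
  have h1 := C.positive i e he w hw hxe h0
  have h2 : CoorientedAt (fun v => (e (C.collar i v) : ℂ)) f w :=
    h1.symm.trans (coorientedAt_of_hasDerivAt hf hf' hc)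
  have h3 : CoorientedAt (fun x => (e x : ℂ)) (fun x => f ((C.collar i).symm x))
      (C.collar i w) := by
    refine CoorientedAt.of_comp (C.collar i) hw (h2.congr (.rfl) ?_)
    filter_upwards [(C.collar i).open_source.mem_nhds hw] with v hv
    rw [(C.collar i).left_inv hv]
  exact (((coorientedAt_comp_iff C.inner.2.isOpenEmbedding_subtypeVal ⟨_, hx⟩).2 h3)).congr .rfl hev

/-- The logarithmic coordinate on a slit collar, in which `K` is the closed half-plane. -/
noncomputable def logChart (j : J) (u : Circle) : OpenPartialHomeomorph S.carrier ℂ :=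
  (C.collar j).symm.trans <|
    (Homeomorph.mulLeft₀ (u : ℂ) u.coe_ne_zero).toOpenPartialHomeomorph.trans <|
      Complex.expOpenPartialHomeomorph.symm.trans
        (Homeomorph.mulLeft₀ Complex.I Complex.I_ne_zero).toOpenPartialHomeomorph

theorem mem_logChart_source {j : J} {u : Circle} {x : S.carrier} :
    x ∈ (C.logChart j u).source ↔
      x ∈ (C.collar j).target ∧ (u : ℂ) * (C.collar j).symm x ∈ Complex.slitPlane := by
  simp [logChart, Complex.expOpenPartialHomeomorph]

theorem logChart_apply {j : J} {u : Circle} {x : S.carrier} :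
    C.logChart j u x = Complex.I * Complex.log (u * (C.collar j).symm x) := by
  simp [logChart, Complex.expOpenPartialHomeomorph]

/-- The factor `I` turns `log ‖w‖` into the height, so `‖w‖ = 1` becomes the real axis and `1 ≤ ‖w‖`
the upper side. The rotation by `u` moves only the slit. -/
theorem im_logChart {j : J} {u : Circle} {x : S.carrier} :
    (C.logChart j u x).im = Real.log ‖(C.collar j).symm x‖ := by
  rw [C.logChart_apply, Complex.I_mul_im, Complex.log_re, norm_mul, Circle.norm_coe, one_mul]

theorem mem_K_iff_symm {j : J} {x : S.carrier} (hx : x ∈ (C.collar j).target) :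
    x ∈ C.K ↔ 1 ≤ ‖(C.collar j).symm x‖ := by
  rw [← C.mem_K_iff j _ ((C.collar j).map_target hx), (C.collar j).right_inv hx]

theorem mem_K_iff_logChart (j : J) (u : Circle) (x : S.carrier)
    (hx : x ∈ (C.logChart j u).source) :
    x ∈ range (Subtype.val : C.K → S.carrier) ↔ 0 ≤ (C.logChart j u x).im := by
  rw [C.mem_logChart_source] at hx
  have hs := C.mem_source.1 ((C.collar j).map_target hx.1)
  rw [Subtype.range_coe, C.mem_K_iff_symm hx.1, C.im_logChart, Real.log_nonneg_iff (by linarith)]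

/-- The chart of `K` on a slit collar. -/
noncomputable def collarChart [Nonempty C.K] (j : J) (u : Circle) :
    OpenPartialHomeomorph C.K ClosedHalfPlane :=
  halfPlaneChart IsEmbedding.subtypeVal (C.logChart j u) (C.mem_K_iff_logChart j u)

theorem mem_collarChart_source [Nonempty C.K] {j : J} {u : Circle} {x : C.K} :
    x ∈ (C.collarChart j u).source ↔ (x : S.carrier) ∈ (C.logChart j u).source := .rfl

theorem collarChart_apply [Nonempty C.K] {j : J} {u : Circle} {x : C.K}
    (hx : x ∈ (C.collarChart j u).source) :
    (C.collarChart j u x : ℂ) = C.logChart j u x :=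
  halfPlaneChart_apply _ _ _ hx

theorem isPositiveChart_collarChart [Nonempty C.K] (j : J) (u : Circle) :
    IsPositiveChart C.innerToK (C.collarChart j u) := by
  refine C.isPositiveChart _ fun o ho => ?_
  have ho' := C.mem_logChart_source.1 (C.mem_collarChart_source.1 ho)
  have hs := (C.collar j).map_target ho'.1
  have hne : (C.collar j).symm o ≠ 0 := by
    intro h
    have := C.mem_source.1 hs
    erw [h] at this
    norm_num at this
  refine ⟨j, (C.collar j).symm o, hs, (C.collar j).right_inv ho'.1,
    fun w => Complex.I * Complex.log (u * w), _,
    ((((hasDerivAt_id _).const_mul (u : ℂ)).clog ho'.2).const_mul _), ?_, ?_, ?_⟩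
  · refine mul_ne_zero Complex.I_ne_zero (div_ne_zero ?_ (Complex.slitPlane_ne_zero ho'.2))
    simp
  · have hc : ContinuousAt (fun w : ℂ => (u : ℂ) * w) ((C.collar j).symm o) := by fun_prop
    filter_upwards [hc (Complex.isOpen_slitPlane.mem_nhds ho'.2)] with w hw
    have hw' : (u : ℂ) * w ∈ Complex.slitPlane := hw
    fun_prop (disch := assumption)
  · filter_upwards [((C.collarChart j u).open_source.preimage
      C.isOpenEmbedding_innerToK.continuous).mem_nhds ho] with p hp
    rw [C.collarChart_apply hp, C.logChart_apply]
    rfl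

theorem exists_collarChart {x : C.K} (hx : x ∉ range C.innerToK) :
    ∃ (_ : Nonempty C.K) (j : J) (u : Circle), x ∈ (C.collarChart j u).source := by
  have : Nonempty C.K := ⟨x⟩
  rw [C.mem_range_innerToK, C.mem_inner] at hx
  simp only [x.2, true_and, not_forall, not_not] at hx
  obtain ⟨j, w, hw, hwx⟩ := hx
  have hs := C.sphere_subset_source j hw
  rw [mem_sphere_zero_iff_norm] at hw
  obtain ⟨u, rfl⟩ : ∃ u : Circle, (u : ℂ) = w := ⟨⟨w, mem_sphere_zero_iff_norm.2 hw⟩, rfl⟩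
  -- Rotating by `u⁻¹` brings the point to `1`, away from the slit.
  refine ⟨this, j, u⁻¹, ?_⟩
  rw [C.mem_collarChart_source, C.mem_logChart_source, ← hwx, (C.collar j).left_inv hs]
  refine ⟨(C.collar j).map_source hs, ?_⟩
  rw [Circle.coe_inv, inv_mul_cancel₀ u.coe_ne_zero]
  exact Complex.one_mem_slitPlane

/-- Outside the inner part `‖w‖ = 1`, so the height `log ‖w‖` vanishes. Hence no orientation
condition arises at the bounding circles. -/
theorem im_collarChart [Nonempty C.K] {j : J} {u : Circle} {x : C.K}
    (hx : x ∈ (C.collarChart j u).source) (hx' : x ∉ range C.innerToK) :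
    (C.collarChart j u x : ℂ).im = 0 := by
  rw [C.collarChart_apply hx, C.im_logChart]
  have ht := (C.mem_logChart_source.1 (C.mem_collarChart_source.1 hx)).1
  have hs := (C.collar j).map_target ht
  rw [C.mem_range_innerToK, ← (C.collar j).right_inv ht, C.collar_mem_inner hs, not_lt] at hx'
  rw [le_antisymm hx' ((C.mem_K_iff_symm ht).1 x.2), Real.log_one]

/-- The inner part and the collars of `K`. -/
noncomputable def pieces : SurfacePieces S C.inner C.innerToK where
  isOpenEmbedding := C.isOpenEmbedding_innerToK
  charts := {a | ∃ (_ : Nonempty C.K) (j : J) (u : Circle), a = C.collarChart j u}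
  cover x hx := by
    obtain ⟨h, j, u, hx⟩ := C.exists_collarChart hx
    exact ⟨_, ⟨h, j, u, rfl⟩, hx⟩
  positive := by
    rintro _ ⟨h, j, u, rfl⟩
    exact C.isPositiveChart_collarChart j u
  compatible := by
    rintro _ ⟨h, j, u, rfl⟩ b - x hx hxa - h0
    rw [C.im_collarChart hxa hx] at h0
    exact absurd h0 (lt_irrefl _)

theorem mem_range_of_pos {a : OpenPartialHomeomorph C.K ClosedHalfPlane}
    (ha : a ∈ C.pieces.fullAtlas) {x : C.K} (hx : x ∈ a.source) (h0 : 0 < (a x : ℂ).im) :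
    x ∈ range C.innerToK := by
  by_contra hx'
  rcases ha with ⟨hO, e, he, rfl⟩ | ⟨h, j, u, rfl⟩
  · rw [liftChart_source] at hx
    exact hx' (image_subset_range _ _ hx)
  · rw [C.im_collarChart hx hx'] at h0
    exact lt_irrefl _ h0

/-- The part `K` as a surface. -/
noncomputable def surface : OrientedSurface.{u} :=
  haveI : CompactSpace C.K := isCompact_iff_compactSpace.1 C.isClosed_K.isCompact
  C.pieces.toSurface

/-- A map from the surface `K` preserves the orientation if it does so as a map from a part
of `S`. -/
theorem preservesOrientation {T : OrientedSurface.{u}} {f : C.K → T.carrier}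
    (hf : PreservesOrientationOn S T C.K f) : PreservesOrientation C.surface T f := by
  intro a ha e' he' x hx hx' h0 h0'
  obtain ⟨o, rfl⟩ := C.mem_range_of_pos ha hx h0
  obtain ⟨e, he, hoe, he0, h⟩ := C.pieces.isPositiveChart ha o hx h0
  have h1 := hf e he e' he' (C.innerToK o) (C.inner_subset_interior o.2) hoe hx' he0 h0'
  refine CoorientedAt.trans ?_ h1
  exact (coorientedAt_comp_iff (b := fun y : C.K => (e (y : S.carrier) : ℂ))
    C.isOpenEmbedding_innerToK o).1 h.symm

theorem preservesOrientationOn_subtypeVal : PreservesOrientationOn S S C.K Subtype.val := by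
  intro e he e' he' x hxi hx hx' h h'
  have := S.oriented e he e' he' x ⟨hx, hx'⟩ h h'
  have h2 := (coorientedAt_comp_iff C.inner.2.isOpenEmbedding_subtypeVal
    ⟨x, C.interior_K_subset hxi⟩).2 this
  exact (coorientedAt_comp_iff (a := fun y : C.K => (e (y : S.carrier) : ℂ))
    (b := fun y : C.K => (e' (y : S.carrier) : ℂ)) C.isOpenEmbedding_innerToK
      ⟨x, C.interior_K_subset hxi⟩).1 h2

section Diagram

variable {m n : ℕ} {D : DoodleDiagram.{u} m n} (C : CollaredPart D.surface J)

/-- The doodle diagram on the part `K` of the surface. -/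
noncomputable def diagram (hD : ∀ q, D.curve q ∈ C.inner) : DoodleDiagram.{u} m n :=
  D.push C.surface C.inner hD (j := C.innerToK) C.isOpenEmbedding_innerToK

/-- The result of gluing pieces to `K` is stably equivalent to the given diagram. -/
theorem stablyEquivalent_of_isResult (hD : ∀ q, D.curve q ∈ C.inner) {E : DoodleDiagram.{u} m n}
    {Q : Type u} [TopologicalSpace Q] {ι : C.K → Q} (hι : Continuous ι)
    (hι' : Function.Injective ι) (hE : IsResult D E C.K ι) :
    StablyEquivalent D E ∧ StablyEquivalent E D := by
  obtain ⟨φ, ho, hc⟩ := hE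
  have : CompactSpace C.K := isCompact_iff_compactSpace.1 C.isClosed_K.isCompact
  have h1 := geotopic_of_isEmbedding (D := C.diagram hD) (E := D)
    (f := (Subtype.val : C.K → D.surface.carrier)) IsEmbedding.subtypeVal
    (C.preservesOrientation C.preservesOrientationOn_subtypeVal) fun s => rfl
  -- A continuous injection of a compact space into a Hausdorff space is an embedding.
  have hemb : IsEmbedding fun x => φ (ι x) :=
    ((φ.continuous.comp hι).isClosedEmbedding (φ.injective.comp hι')).isEmbedding
  have h2 := geotopic_of_isEmbedding (D := C.diagram hD) (E := E) (f := fun x => φ (ι x)) hemb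
    (C.preservesOrientation ho) fun s => by
      obtain ⟨hs, h⟩ := hc s
      exact h.symm
  exact ⟨.tail (.single h1.2) h2.1, .tail (.single h2.2) h1.1⟩

end Diagram

end CollaredPart

/-! ### Charts by compactness, and pieces glued to the bounding circles -/

/-- A continuous injective map on an open set is a chart if compact sets of the source cover
neighbourhoods of the points of the target. -/
noncomputable def chartOfCompacts {X Y : Type*} [TopologicalSpace X] [TopologicalSpace Y]
    [T2Space Y] [Nonempty X] {a : X → Y} {U : Set X} {A : Set Y} (hU : IsOpen U) (hA : IsOpen A)
    (ha : ContinuousOn a U) (hinj : InjOn a U) (hmaps : MapsTo a U A)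
    (h : ∀ y ∈ A, ∃ C ⊆ U, IsCompact C ∧ a '' C ∈ 𝓝 y) : OpenPartialHomeomorph X Y where
  toFun := a
  invFun := Function.invFunOn a U
  source := U
  target := A
  map_source' := hmaps
  map_target' y hy := by
    obtain ⟨C, hCU, -, hC⟩ := h y hy
    exact Function.invFunOn_mem (image_mono hCU (mem_of_mem_nhds hC))
  left_inv' x hx := hinj.leftInvOn_invFunOn hx
  right_inv' y hy := by
    obtain ⟨C, hCU, -, hC⟩ := h y hy
    exact Function.invFunOn_eq (image_mono hCU (mem_of_mem_nhds hC))
  open_source := hU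
  open_target := hA
  continuousOn_toFun := ha
  continuousOn_invFun := by
    intro y hy
    obtain ⟨C, hCU, hCc, hC⟩ := h y hy
    refine ContinuousAt.continuousWithinAt (ContinuousOn.continuousAt ?_ hC)
    -- The preimage of a closed set `t` under the inverse is, within `a '' C`, the image of the
    -- compact set `C ∩ t`, which is closed because the target is Hausdorff.
    rw [continuousOn_iff_isClosed]
    intro t ht
    refine ⟨a '' (C ∩ t), ((hCc.inter_right ht).image_of_continuousOn
      (ha.mono (inter_subset_left.trans hCU))).isClosed, ?_⟩
    ext z
    constructor
    · rintro ⟨hz, x, hx, rfl⟩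
      rw [mem_preimage, hinj.leftInvOn_invFunOn (hCU hx)] at hz
      exact ⟨⟨x, ⟨hx, hz⟩, rfl⟩, x, hx, rfl⟩
    · rintro ⟨⟨x, hx, rfl⟩, -⟩
      refine ⟨?_, x, hx.1, rfl⟩
      rw [mem_preimage, hinj.leftInvOn_invFunOn (hCU hx.1)]
      exact hx.2

/-- Pieces that are glued to the boundary circles of a part of a surface. The space `B` is the
disjoint union of the pieces, indexed by `F`. A piece and the collars at its rim are parametrized
together by an open set `A` of the plane; the coordinate is `β` on the piece, and a holomorphic
function `trans j` of the coordinate of the collar. -/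
structure Filling {S : OrientedSurface.{u}} {J : Type} (C : CollaredPart S J) (B F : Type)
    [TopologicalSpace B] where
  piece : B → F
  collarPiece : J → F
  isClopen_piece : ∀ f, IsClopen (piece ⁻¹' {f})
  rim : Set B
  attach : B → S.carrier
  β : B → ℂ
  continuous_β : Continuous β
  trans : J → ℂ → ℂ
  trans_deriv : ∀ j, ∀ w ∈ (C.collar j).source, ∃ f', f' ≠ 0 ∧ HasDerivAt (trans j) f' w
  attach_rim : ∀ b ∈ rim, ∃ j w, collarPiece j = piece b ∧ ‖w‖ = 1 ∧
    attach b = C.collar j w ∧ β b = trans j w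
  trans_inj : ∀ i j v w, collarPiece i = collarPiece j → 1 ≤ ‖v‖ → ‖v‖ < 2 → 1 ≤ ‖w‖ → ‖w‖ < 2 →
    trans i v = trans j w → i = j ∧ v = w
  trans_ne : ∀ j w, ∀ b ∉ rim, collarPiece j = piece b → 1 ≤ ‖w‖ → ‖w‖ < 2 → trans j w ≠ β b
  β_inj : ∀ b ∉ rim, ∀ b' ∉ rim, piece b = piece b' → β b = β b' → b = b'
  A : Set ℂ
  isOpen_A : IsOpen A
  A_subset : A ⊆ Metric.ball 0 2
  trans_mem : ∀ j w, 1 ≤ ‖w‖ → ‖w‖ < 2 → trans j w ∈ A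
  β_mem : ∀ b, β b ∈ A
  -- The bound `s < 2` confines the collar points used near `z` to a compact annulus; this supplies
  -- the compact sets for `chartOfCompacts`.
  surj : ∀ f, ∀ z ∈ A, ∃ s < 2, ∀ᶠ y in 𝓝 z, (∃ b, piece b = f ∧ β b = y) ∨
    ∃ j w, collarPiece j = f ∧ 1 ≤ ‖w‖ ∧ ‖w‖ ≤ s ∧ trans j w = y
  -- The core contains the coordinates of the piece and its rim but meets the collars only up to
  -- radius `3 / 2`; it serves to separate points in the proof that the glued space is Hausdorff.
  core : Set ℂ
  isOpen_core : IsOpen core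
  β_mem_core : ∀ b, β b ∈ core
  trans_mem_core : ∀ j w, ‖w‖ = 1 → trans j w ∈ core
  norm_le_of_mem_core : ∀ j w, 1 ≤ ‖w‖ → ‖w‖ < 2 → trans j w ∈ core → ‖w‖ ≤ 3 / 2

namespace Filling

variable {S : OrientedSurface.{u}} {J : Type} {C : CollaredPart S J} {B F : Type}
  [TopologicalSpace B] (P : Filling C B F)

theorem attach_mem {b : B} (hb : b ∈ P.rim) : P.attach b ∈ C.K := by
  obtain ⟨j, w, -, hw, h, -⟩ := P.attach_rim b hb
  rw [h, C.mem_K_iff j w (C.sphere_subset_source j (mem_sphere_zero_iff_norm.2 hw)), hw]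

/-- The coordinate on the collars. -/
noncomputable def α (x : S.carrier) : ℂ :=
  open Classical in
  if h : ∃ j, x ∈ (C.collar j).target then P.trans h.choose ((C.collar h.choose).symm x) else 0

theorem α_of_mem {j : J} {x : S.carrier} (hx : x ∈ (C.collar j).target) :
    P.α x = P.trans j ((C.collar j).symm x) := by
  have h : ∃ j, x ∈ (C.collar j).target := ⟨j, hx⟩
  have hj : h.choose = j := by
    by_contra hne
    exact (C.disjoint_target _ _ hne).ne_of_mem h.choose_spec hx rfl
  rw [α, dif_pos h, hj]

theorem α_collar {j : J} {w : ℂ} (hw : w ∈ (C.collar j).source) :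
    P.α (C.collar j w) = P.trans j w := by
  rw [P.α_of_mem ((C.collar j).map_source hw), (C.collar j).left_inv hw]

theorem continuousAt_α {j : J} {x : S.carrier} (hx : x ∈ (C.collar j).target) :
    ContinuousAt P.α x := by
  have h : P.α =ᶠ[𝓝 x] fun y => P.trans j ((C.collar j).symm y) := by
    filter_upwards [(C.collar j).open_target.mem_nhds hx] with y hy using P.α_of_mem hy
  refine ContinuousAt.congr ?_ h.symm
  obtain ⟨f', -, hf⟩ := P.trans_deriv j _ ((C.collar j).map_target hx)
  exact ContinuousAt.comp (f := (C.collar j).symm) hf.continuousAt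
    ((C.collar j).symm.continuousAt hx)

/-- The gluing relation. -/
def IsGlue (r : C.K ⊕ B → C.K ⊕ B → Prop) : Prop :=
  ∀ p q, r p q ↔ ∃ (x : C.K) (b : B), p = Sum.inl x ∧ q = Sum.inr b ∧ b ∈ P.rim ∧ x = P.attach b

section Glue

variable {r : C.K ⊕ B → C.K ⊕ B → Prop}

/-- The natural map from `K` to the space obtained by gluing. -/
def ofK (r : C.K ⊕ B → C.K ⊕ B → Prop) (x : C.K) : Quot r := Quot.mk r (Sum.inl x)

/-- The natural map from the pieces to the space obtained by gluing. -/
def ofB (r : C.K ⊕ B → C.K ⊕ B → Prop) (b : B) : Quot r := Quot.mk r (Sum.inr b)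

theorem continuous_ofK : Continuous (ofK r) := continuous_quot_mk.comp continuous_inl

theorem ofB_of_rim (hr : P.IsGlue r) {b : B} (hb : b ∈ P.rim) :
    ofB r b = ofK r ⟨P.attach b, P.attach_mem hb⟩ :=
  (Quot.sound ((hr _ _).2 ⟨_, b, rfl, rfl, hb, rfl⟩)).symm

/-- A normal form of the points of the space obtained by gluing. -/
noncomputable def rep (hr : P.IsGlue r) : Quot r → S.carrier ⊕ B :=
  open Classical in
  Quot.lift (Sum.elim (fun x => Sum.inl x)
    (fun b => if b ∈ P.rim then Sum.inl (P.attach b) else Sum.inr b)) (by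
      intro p q h
      obtain ⟨x, b, rfl, rfl, hb, hx⟩ := (hr p q).1 h
      simp [hb, hx])

variable (hr : P.IsGlue r)

theorem rep_ofK (x : C.K) : P.rep hr (ofK r x) = Sum.inl (x : S.carrier) := rfl

theorem rep_ofB {b : B} (hb : b ∉ P.rim) : P.rep hr (ofB r b) = Sum.inr b := if_neg hb

include hr in
theorem ofK_injective : Function.Injective (ofK r) := fun x y h => by
  have := congrArg (P.rep hr) h
  exact Subtype.ext (Sum.inl_injective this)

include hr in
theorem eq_ofK_or_ofB (q : Quot r) : (∃ x, q = ofK r x) ∨ ∃ b ∉ P.rim, q = ofB r b := by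
  obtain ⟨x | b, rfl⟩ := Quot.exists_rep q
  · exact Or.inl ⟨x, rfl⟩
  · by_cases hb : b ∈ P.rim
    · exact Or.inl ⟨_, P.ofB_of_rim hr hb⟩
    · exact Or.inr ⟨b, hb, rfl⟩

include hr in
theorem ofB_eq_ofK {b : B} {x : C.K} (h : ofB r b = ofK r x) : b ∈ P.rim ∧ P.attach b = x := by
  by_cases hb : b ∈ P.rim
  · rw [P.ofB_of_rim hr hb] at h
    exact ⟨hb, congrArg Subtype.val (P.ofK_injective hr h)⟩
  · have := congrArg (P.rep hr) h
    rw [P.rep_ofB hr hb, P.rep_ofK] at this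
    exact absurd this Sum.inr_ne_inl

/-- The coordinate on the pieces and collars. -/
noncomputable def coord (q : Quot r) : ℂ := Sum.elim P.α P.β (P.rep hr q)

theorem coord_ofK (x : C.K) : P.coord hr (ofK r x) = P.α x := rfl

/-- On the rim the coordinate is computed through the collar, and `attach_rim` says that this agrees
with `β`. -/
theorem coord_ofB (b : B) : P.coord hr (ofB r b) = P.β b := by
  by_cases hb : b ∈ P.rim
  · rw [P.ofB_of_rim hr hb, P.coord_ofK]
    obtain ⟨j, w, -, hw, h, h'⟩ := P.attach_rim b hb
    change P.α (P.attach b) = _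
    rw [h, P.α_collar (C.sphere_subset_source j (mem_sphere_zero_iff_norm.2 hw)), h']
  · rw [coord, P.rep_ofB hr hb]; rfl

variable (r) in
/-- The union of a piece and the collars at its rim. -/
def region (f : F) : Set (Quot r) :=
  ofB r '' (P.piece ⁻¹' {f}) ∪ ofK r '' {x | ∃ j, P.collarPiece j = f ∧ ↑x ∈ (C.collar j).target}

include hr in
theorem ofK_mem_region {f : F} {x : C.K} :
    ofK r x ∈ P.region r f ↔ ∃ j, P.collarPiece j = f ∧ (x : S.carrier) ∈ (C.collar j).target := by
  constructor
  · rintro (⟨b, hb, h⟩ | ⟨y, hy, h⟩)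
    · obtain ⟨hb', hx⟩ := P.ofB_eq_ofK hr h
      obtain ⟨j, w, hj, hw, h', -⟩ := P.attach_rim b hb'
      refine ⟨j, hj.trans hb, ?_⟩
      rw [← hx, h']
      exact (C.collar j).map_source (C.sphere_subset_source j (mem_sphere_zero_iff_norm.2 hw))
    · rwa [← P.ofK_injective hr h]
  · exact fun h => Or.inr ⟨x, h, rfl⟩

include hr in
theorem ofB_mem_region {f : F} {b : B} : ofB r b ∈ P.region r f ↔ P.piece b = f := by
  refine ⟨fun h => ?_, fun h => Or.inl ⟨b, h, rfl⟩⟩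
  by_cases hb : b ∈ P.rim
  · rw [P.ofB_of_rim hr hb, P.ofK_mem_region hr] at h
    obtain ⟨i, rfl, hi⟩ := h
    obtain ⟨j, w, hj, hw, h', -⟩ := P.attach_rim b hb
    rw [← hj]
    by_contra hne
    refine (C.disjoint_target j i fun e => hne (e ▸ rfl)).ne_of_mem ?_ hi h'.symm
    exact (C.collar j).map_source (C.sphere_subset_source j (mem_sphere_zero_iff_norm.2 hw))
  · rcases h with ⟨b', hb', h⟩ | ⟨x, -, h⟩
    · by_cases hbr : b' ∈ P.rim
      · rw [P.ofB_of_rim hr hbr] at h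
        exact absurd (P.ofB_eq_ofK hr h.symm).1 hb
      · have := congrArg (P.rep hr) h
        rw [P.rep_ofB hr hb, P.rep_ofB hr hbr] at this
        rw [← Sum.inr_injective this]
        exact hb'
    · exact absurd (P.ofB_eq_ofK hr h.symm).1 hb

include hr in
theorem region_cases {f : F} {q : Quot r} (hq : q ∈ P.region r f) :
    (∃ b ∉ P.rim, P.piece b = f ∧ q = ofB r b) ∨
      ∃ (x : C.K) (j : J) (w : ℂ), P.collarPiece j = f ∧ 1 ≤ ‖w‖ ∧ ‖w‖ < 2 ∧
        w ∈ (C.collar j).source ∧ (x : S.carrier) = C.collar j w ∧ q = ofK r x := by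
  rcases P.eq_ofK_or_ofB hr q with ⟨x, rfl⟩ | ⟨b, hb, rfl⟩
  · obtain ⟨j, hj, hx⟩ := (P.ofK_mem_region hr).1 hq
    have hw := (C.collar j).map_target hx
    exact Or.inr ⟨x, j, _, hj, (C.mem_K_iff_symm hx).1 x.2, (C.mem_source.1 hw).2, hw,
      ((C.collar j).right_inv hx).symm, rfl⟩
  · exact Or.inl ⟨b, hb, (P.ofB_mem_region hr).1 hq, rfl⟩

include hr in
-- Distinct collars are disjoint and each belongs to one piece, so the regions of different pieces
-- are disjoint.
theorem region_unique {f g : F} {q : Quot r} (hf : q ∈ P.region r f) (hg : q ∈ P.region r g) :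
    f = g := by
  rcases P.eq_ofK_or_ofB hr q with ⟨x, rfl⟩ | ⟨b, hb, rfl⟩
  · obtain ⟨i, rfl, hi⟩ := (P.ofK_mem_region hr).1 hf
    obtain ⟨j, rfl, hj⟩ := (P.ofK_mem_region hr).1 hg
    by_contra hne
    exact (C.disjoint_target i j fun e => hne (e ▸ rfl)).ne_of_mem hi hj rfl
  · exact ((P.ofB_mem_region hr).1 hf).symm.trans ((P.ofB_mem_region hr).1 hg)

theorem isOpen_quot_iff {O : Set (Quot r)} :
    IsOpen O ↔ IsOpen (ofK r ⁻¹' O) ∧ IsOpen (ofB r ⁻¹' O) := by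
  rw [← isQuotientMap_quot_mk.isOpen_preimage, isOpen_sum_iff]
  rfl

include hr in
theorem isOpen_region (f : F) : IsOpen (P.region r f) := by
  rw [isOpen_quot_iff]
  constructor
  · have : ofK r ⁻¹' P.region r f =
        Subtype.val ⁻¹' ⋃ j ∈ {j | P.collarPiece j = f}, (C.collar j).target := by
      ext x
      simp [P.ofK_mem_region hr]
    rw [this]
    exact (isOpen_biUnion fun j _ => (C.collar j).open_target).preimage continuous_subtype_val
  · have : ofB r ⁻¹' P.region r f = P.piece ⁻¹' {f} := by
      ext b
      exact P.ofB_mem_region hr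
    rw [this]
    exact (P.isClopen_piece f).isOpen

theorem continuousOn_coord (f : F) : ContinuousOn (P.coord hr) (P.region r f) := by
  rw [isQuotientMap_quot_mk.continuousOn_isOpen_iff (P.isOpen_region hr f)]
  rintro (x | b) hp
  · obtain ⟨j, -, hx⟩ := (P.ofK_mem_region hr).1 hp
    refine ContinuousAt.continuousWithinAt (IsOpenEmbedding.inl.continuousAt_iff.1 ?_)
    exact (P.continuousAt_α hx).comp continuous_subtype_val.continuousAt
  · refine ContinuousAt.continuousWithinAt (IsOpenEmbedding.inr.continuousAt_iff.1 ?_)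
    exact P.continuous_β.continuousAt.congr (.of_forall fun b => (P.coord_ofB hr b).symm)

/-- Each point of the region is either off the rim in the piece or on a collar; the resulting cases
are `β_inj`, `trans_ne` (twice) and `trans_inj`. -/
theorem injOn_coord (f : F) : InjOn (P.coord hr) (P.region r f) := by
  intro p hp q hq h
  rcases P.region_cases hr hp with ⟨b, hb, hbf, rfl⟩ | ⟨x, i, v, hi, hv, hv', hvs, hx, rfl⟩ <;>
  rcases P.region_cases hr hq with ⟨b', hb', hbf', rfl⟩ | ⟨y, j, w, hj, hw, hw', hws, hy, rfl⟩ <;>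
  simp only [P.coord_ofB, P.coord_ofK] at h
  · rw [P.β_inj b hb b' hb' (hbf.trans hbf'.symm) h]
  · rw [hy, P.α_collar hws] at h
    exact absurd h.symm (P.trans_ne j w b hb (hj.trans hbf.symm) hw hw')
  · rw [hx, P.α_collar hvs] at h
    exact absurd h (P.trans_ne i v b' hb' (hi.trans hbf'.symm) hv hv')
  · rw [hx, hy, P.α_collar hvs, P.α_collar hws] at h
    obtain ⟨rfl, rfl⟩ := P.trans_inj i j v w (hi.trans hj.symm) hv hv' hw hw' h
    rw [Subtype.ext (hx.trans hy.symm)]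

theorem mapsTo_coord (f : F) : MapsTo (P.coord hr) (P.region r f) P.A := by
  intro p hp
  rcases P.region_cases hr hp with ⟨b, hb, hbf, rfl⟩ | ⟨x, i, v, hi, hv, hv', hvs, hx, rfl⟩
  · rw [P.coord_ofB]
    exact P.β_mem b
  · rw [P.coord_ofK, hx, P.α_collar hvs]
    exact P.trans_mem i v hv hv'

theorem isCompact_collar_image (j : J) {s : ℝ} (hs : s < 2) :
    IsCompact (C.collar j '' {w | 1 ≤ ‖w‖ ∧ ‖w‖ ≤ s}) := by
  have h : IsCompact {w : ℂ | 1 ≤ ‖w‖ ∧ ‖w‖ ≤ s} := by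
    have : {w : ℂ | 1 ≤ ‖w‖ ∧ ‖w‖ ≤ s} = Metric.closedBall 0 s ∩ {w | 1 ≤ ‖w‖} := by
      ext w
      simp [and_comm]
    rw [this]
    exact (isCompact_closedBall _ _).inter_right (isClosed_le continuous_const continuous_norm)
  refine h.image_of_continuousOn ((C.collar j).continuousOn.mono fun w hw => ?_)
  exact C.mem_source.2 ⟨by linarith [hw.1], by linarith [hw.2]⟩

variable (r) in
/-- The embedding of the inner part of `K` in the space obtained by gluing. -/
def ofInner (o : C.inner) : Quot r := ofK r (C.innerToK o)

include hr in
theorem ofB_notMem_range_ofInner (b : B) : ofB r b ∉ range (ofInner r) := by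
  rintro ⟨o, h⟩
  obtain ⟨hb, h'⟩ := P.ofB_eq_ofK hr h.symm
  obtain ⟨j, w, -, hw, h2, -⟩ := P.attach_rim b hb
  have hws := C.sphere_subset_source j (mem_sphere_zero_iff_norm.2 hw)
  have h3 : C.collar j w ∈ C.inner := by
    rw [← h2, h']
    exact o.2
  rw [C.collar_mem_inner hws, hw] at h3
  exact lt_irrefl _ h3

include hr in
-- Nothing is glued to the inner part, so the image of an open set has empty preimage in the pieces
-- and is open in the quotient.
theorem isOpenEmbedding_ofInner : IsOpenEmbedding (ofInner r) := by
  refine .of_continuous_injective_isOpenMap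
    (continuous_ofK.comp C.isOpenEmbedding_innerToK.continuous)
    ((P.ofK_injective hr).comp C.isOpenEmbedding_innerToK.injective) fun O hO => ?_
  rw [isOpen_quot_iff]
  constructor
  · have : ofK r ⁻¹' (ofInner r '' O) = C.innerToK '' O := by
      rw [show ofInner r = ofK r ∘ C.innerToK from rfl, image_comp,
        preimage_image_eq _ (P.ofK_injective hr)]
    rw [this]
    exact C.isOpenEmbedding_innerToK.isOpenMap _ hO
  · have : ofB r ⁻¹' (ofInner r '' O) = ∅ := eq_empty_of_forall_notMem fun b hb =>
      P.ofB_notMem_range_ofInner hr b (image_subset_range _ _ hb)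
    rw [this]
    exact isOpen_empty

include hr in
theorem exists_region {q : Quot r} (hq : q ∉ range (ofInner r)) :
    ∃ f, q ∈ P.region r f ∧ P.coord hr q ∈ P.core := by
  rcases P.eq_ofK_or_ofB hr q with ⟨x, rfl⟩ | ⟨b, hb, rfl⟩
  · have hx : (x : S.carrier) ∉ C.inner := by
      intro hx
      obtain ⟨o, rfl⟩ := C.mem_range_innerToK.2 hx
      exact hq ⟨o, rfl⟩
    rw [C.mem_inner] at hx
    simp only [x.2, true_and, not_forall, not_not] at hx
    obtain ⟨j, w, hw, h⟩ := hx
    have hws := C.sphere_subset_source j hw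
    refine ⟨P.collarPiece j, (P.ofK_mem_region hr).2 ⟨j, rfl, ?_⟩, ?_⟩
    · rw [← h]
      exact (C.collar j).map_source hws
    · rw [P.coord_ofK, ← h, P.α_collar hws]
      exact P.trans_mem_core j w (mem_sphere_zero_iff_norm.1 hw)
  · exact ⟨P.piece b, (P.ofB_mem_region hr).2 rfl, by rw [P.coord_ofB]; exact P.β_mem_core b⟩

variable [Finite J]

include hr in
-- Two points in regions are separated by the coordinate, or by the disjointness of the regions; two
-- inner points are separated in `S`. What remains is a point outside the inner part and an inner
-- point on no collar of a region: the core neighbourhood of the former reaches the collars only up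
-- to radius `3 / 2`, and the latter avoids the compact union of these closed annuli.
theorem t2Space : T2Space (Quot r) := by
  have hreg : ∀ f g p q, p ∈ P.region r f → q ∈ P.region r g → p ≠ q → Disjoint (𝓝 p) (𝓝 q) := by
    intro f g p q hp hq hpq
    by_cases hfg : f = g
    · subst hfg
      have h1 := (P.continuousOn_coord hr f).continuousAt ((P.isOpen_region hr f).mem_nhds hp)
      have h2 := (P.continuousOn_coord hr f).continuousAt ((P.isOpen_region hr f).mem_nhds hq)
      exact h1.disjoint (disjoint_nhds_nhds.2 fun h => hpq (P.injOn_coord hr f hp hq h)) h2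
    · exact Filter.disjoint_of_disjoint_of_mem
        (disjoint_left.2 fun y hy hy' => hfg (P.region_unique hr hy hy'))
        ((P.isOpen_region hr f).mem_nhds hp) ((P.isOpen_region hr g).mem_nhds hq)
  have hmix : ∀ p q, p ∉ range (ofInner r) → q ∈ range (ofInner r) → Disjoint (𝓝 p) (𝓝 q) := by
    intro p q hp hq
    have hpq : p ≠ q := fun h => hp (h ▸ hq)
    obtain ⟨f, hpf, hpc⟩ := P.exists_region hr hp
    by_cases hqr : ∃ g, q ∈ P.region r g
    · obtain ⟨g, hqg⟩ := hqr
      exact hreg f g p q hpf hqg hpq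
    obtain ⟨o, rfl⟩ := hq
    have hZ : IsClosed (⋃ j, C.collar j '' {w | 1 ≤ ‖w‖ ∧ ‖w‖ ≤ 3 / 2}) :=
      (isCompact_iUnion fun j => isCompact_collar_image j (by norm_num)).isClosed
    have h1 : P.region r f ∩ P.coord hr ⁻¹' P.core ∈ 𝓝 p :=
      ((P.continuousOn_coord hr f).isOpen_inter_preimage (P.isOpen_region hr f)
        P.isOpen_core).mem_nhds ⟨hpf, hpc⟩
    have h2 : ofInner r '' (Subtype.val ⁻¹' (⋃ j, C.collar j '' {w | 1 ≤ ‖w‖ ∧ ‖w‖ ≤ 3 / 2})ᶜ) ∈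
        𝓝 (ofInner r o) := by
      refine (P.isOpenEmbedding_ofInner hr).isOpenMap.image_mem_nhds
        ((hZ.isOpen_compl.preimage continuous_subtype_val).mem_nhds ?_)
      intro ho
      obtain ⟨j, w, hw, h⟩ := mem_iUnion.1 ho
      refine hqr ⟨P.collarPiece j, (P.ofK_mem_region hr).2 ⟨j, rfl, ?_⟩⟩
      change (o : S.carrier) ∈ _
      rw [← h]
      exact (C.collar j).map_source
        (C.mem_source.2 ⟨by linarith [hw.1], by linarith [hw.2]⟩)
    refine Filter.disjoint_of_disjoint_of_mem (disjoint_left.2 ?_) h1 h2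
    rintro _ ⟨hyf, hyc⟩ ⟨o', ho', rfl⟩
    rcases P.region_cases hr hyf with ⟨b, -, -, hb⟩ | ⟨x, j, w, -, hw, hw', hws, hx, h⟩
    · exact P.ofB_notMem_range_ofInner hr b ⟨o', hb⟩
    · obtain rfl := P.ofK_injective hr h
      have h3 : P.coord hr (ofInner r o') = P.trans j w := by
        rw [← P.α_collar hws, ← hx]
        rfl
      rw [mem_preimage, h3] at hyc
      exact ho' (mem_iUnion.2 ⟨j, w, ⟨hw, P.norm_le_of_mem_core j w hw hw' hyc⟩, hx.symm⟩)
  rw [t2Space_iff_disjoint_nhds]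
  intro p q hpq
  by_cases hp : p ∈ range (ofInner r) <;> by_cases hq : q ∈ range (ofInner r)
  · obtain ⟨o, rfl⟩ := hp
    obtain ⟨o', rfl⟩ := hq
    have hj := P.isOpenEmbedding_ofInner hr
    rw [← hj.map_nhds_eq, ← hj.map_nhds_eq, Filter.disjoint_map hj.injective]
    exact disjoint_nhds_nhds.2 fun h => hpq (h ▸ rfl)
  · exact (hmix q p hq hp).symm
  · exact hmix p q hp hq
  · obtain ⟨f, hf, -⟩ := P.exists_region hr hp
    obtain ⟨g, hg, -⟩ := P.exists_region hr hq
    exact hreg f g p q hf hg hpq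

variable [CompactSpace B]

theorem exists_compact (f : F) {z : ℂ} (hz : z ∈ P.A) :
    ∃ Z ⊆ P.region r f, IsCompact Z ∧ P.coord hr '' Z ∈ 𝓝 z := by
  obtain ⟨s, hs, h⟩ := P.surj f z hz
  refine ⟨ofB r '' (P.piece ⁻¹' {f}) ∪ ofK r '' (Subtype.val ⁻¹'
    ⋃ j ∈ {j | P.collarPiece j = f}, C.collar j '' {w | 1 ≤ ‖w‖ ∧ ‖w‖ ≤ s}), ?_, ?_, ?_⟩
  · refine union_subset_union_right _ (image_mono ?_)
    intro x hx
    simp only [mem_preimage, mem_iUnion] at hx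
    obtain ⟨j, hj, w, hw, h'⟩ := hx
    refine ⟨j, hj, h' ▸ (C.collar j).map_source (C.mem_source.2 ?_)⟩
    exact ⟨by linarith [hw.1], by linarith [hw.2]⟩
  · refine IsCompact.union ?_ ?_
    · exact (P.isClopen_piece f).isClosed.isCompact.image
        (continuous_quot_mk.comp continuous_inr)
    · refine IsCompact.image ?_ continuous_ofK
      refine C.isClosed_K.isClosedEmbedding_subtypeVal.isCompact_preimage ?_
      exact (toFinite _).isCompact_biUnion fun j _ => isCompact_collar_image j hs
  · filter_upwards [h] with y hy
    rcases hy with ⟨b, hb, rfl⟩ | ⟨j, w, hj, hw, hw', rfl⟩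
    · exact ⟨_, Or.inl ⟨b, hb, rfl⟩, P.coord_ofB hr b⟩
    · have hws : w ∈ (C.collar j).source := C.mem_source.2 ⟨by linarith, by linarith⟩
      refine ⟨ofK r ⟨C.collar j w, (C.mem_K_iff j w hws).2 hw⟩, Or.inr ⟨_, ?_, rfl⟩, ?_⟩
      · exact mem_biUnion (show j ∈ {j | P.collarPiece j = f} from hj) ⟨w, ⟨hw, hw'⟩, rfl⟩
      · exact P.α_collar hws

/-- The chart of a piece and the collars at its rim, with values in the plane. -/
noncomputable def planeChart [Nonempty (Quot r)] (f : F) : OpenPartialHomeomorph (Quot r) ℂ :=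
  chartOfCompacts (P.isOpen_region hr f) P.isOpen_A (P.continuousOn_coord hr f)
    (P.injOn_coord hr f) (P.mapsTo_coord hr f) fun _ => P.exists_compact hr f

/-- The chart of a piece and the collars at its rim. -/
noncomputable def chart [Nonempty (Quot r)] (f : F) :
    OpenPartialHomeomorph (Quot r) ClosedHalfPlane :=
  -- Since `A` lies in the disk of radius `2`, the shift by `2i` moves it into the open upper
  -- half-plane.
  halfPlaneChart .id ((P.planeChart hr f).trans
    (Homeomorph.addRight (2 * Complex.I)).toOpenPartialHomeomorph) (by
      intro x hx
      have hx' : x ∈ P.region r f := by simpa using! hx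
      have h := P.A_subset (P.mapsTo_coord hr f hx')
      rw [mem_ball_zero_iff] at h
      have h2 := (abs_le.1 (Complex.abs_im_le_norm (P.coord hr x))).1
      have h3 : 0 ≤ (P.coord hr x + 2 * Complex.I).im := by
        simp only [Complex.add_im, Complex.mul_im, Complex.I_im, Complex.I_re, Complex.re_ofNat,
          Complex.im_ofNat]
        linarith
      exact iff_of_true ⟨x, rfl⟩ h3)

theorem mem_chart_source [Nonempty (Quot r)] {f : F} {q : Quot r} :
    q ∈ (P.chart hr f).source ↔ q ∈ P.region r f := by
  change q ∈ P.region r f ∩ _ ↔ _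
  simp

theorem chart_apply [Nonempty (Quot r)] {f : F} {q : Quot r} (hq : q ∈ P.region r f) :
    (P.chart hr f q : ℂ) = P.coord hr q + 2 * Complex.I :=
  halfPlaneChart_apply _ _ _ ((P.mem_chart_source hr).2 hq)

theorem isPositiveChart_chart [Nonempty (Quot r)] (f : F) :
    IsPositiveChart (ofInner r) (P.chart hr f) := by
  refine C.isPositiveChart _ fun o ho => ?_
  rw [P.mem_chart_source] at ho
  obtain ⟨j, hj, hoj⟩ := (P.ofK_mem_region hr).1 ho
  have hs := (C.collar j).map_target hoj
  obtain ⟨f', hf', hf⟩ := P.trans_deriv j _ hs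
  refine ⟨j, _, hs, (C.collar j).right_inv hoj, fun w => P.trans j w + 2 * Complex.I, f',
    hf.add_const _, hf', ?_, ?_⟩
  · filter_upwards [(C.collar j).open_source.mem_nhds hs] with w hw
    obtain ⟨g', -, hg⟩ := P.trans_deriv j _ hw
    exact (hg.add_const _).continuousAt
  · filter_upwards [((C.collar j).open_target.preimage continuous_subtype_val).mem_nhds hoj]
      with p hp
    have hpr : ofInner r p ∈ P.region r f :=
      (P.ofK_mem_region hr (x := C.innerToK p)).2 ⟨j, hj, hp⟩
    rw [P.chart_apply hr hpr, ← P.α_of_mem hp]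
    rfl

/-- The inner part of `K` and the glued pieces. -/
noncomputable def pieces : SurfacePieces S C.inner (ofInner r) where
  isOpenEmbedding := P.isOpenEmbedding_ofInner hr
  charts := {a | ∃ (_ : Nonempty (Quot r)) (f : F), a = P.chart hr f}
  cover q hq := by
    obtain ⟨f, hf, -⟩ := P.exists_region hr hq
    exact ⟨_, ⟨⟨q⟩, f, rfl⟩, (haveI : Nonempty (Quot r) := ⟨q⟩; P.mem_chart_source hr).2 hf⟩
  positive := by
    rintro _ ⟨h, f, rfl⟩
    exact P.isPositiveChart_chart hr f
  compatible := by
    rintro _ ⟨h, f, rfl⟩ _ ⟨h', g, rfl⟩ q - hf hg - -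
    rw [P.mem_chart_source] at hf hg
    obtain rfl := P.region_unique hr hf hg
    exact CoorientedAt.refl _ _

/-- The quotient is compact and Hausdorff, so the atlas of `pieces` makes it a surface. The curves
lie in the inner part and are pushed forward, and the homeomorphism in `IsResult` is the identity.
-/
theorem exists_isResult {m n : ℕ} {D : DoodleDiagram.{u} m n} {C : CollaredPart D.surface J}
    (P : Filling C B F) {r : C.K ⊕ B → C.K ⊕ B → Prop} (hr : P.IsGlue r)
    (hD : ∀ q, D.curve q ∈ C.inner) :
    ∃ E : DoodleDiagram.{u} m n, IsResult D E C.K (ofK r) := by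
  have : T2Space (Quot r) := P.t2Space hr
  have : CompactSpace C.K := isCompact_iff_compactSpace.1 C.isClosed_K.isCompact
  refine ⟨D.push (P.pieces hr).toSurface C.inner hD (j := ofInner r)
    (P.isOpenEmbedding_ofInner hr), Homeomorph.refl _, ?_, fun s => ⟨C.inner_subset (hD s), rfl⟩⟩
  intro e he a ha x hxi hx hx' h h'
  have hxo := C.interior_K_subset hxi
  exact (coorientedAt_comp_iff (a := fun y : C.K => (e (y : D.surface.carrier) : ℂ))
    (b := fun y : C.K => (a (ofK r y) : ℂ)) C.isOpenEmbedding_innerToK ⟨x, hxo⟩).1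
    ((P.pieces hr).coorientedAt_inner he ha ⟨x, hxo⟩ hx hx' h h')

end Glue

end Filling

/-! ### Standard collars and their coordinate changes -/

/-- The annulus that parametrizes the collars. -/
def collarAnnulus : Set ℂ := {w | 1 / 2 < ‖w‖ ∧ ‖w‖ < 2}

theorem isOpen_collarAnnulus : IsOpen collarAnnulus :=
  (isOpen_lt continuous_const continuous_norm).inter (isOpen_lt continuous_norm continuous_const)

/-- The involution `w ↦ 1 / (2 w)` of the punctured plane. -/
noncomputable def halfInv : OpenPartialHomeomorph ℂ ℂ where
  toFun w := (2 * w)⁻¹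
  invFun w := (2 * w)⁻¹
  source := {0}ᶜ
  target := {0}ᶜ
  map_source' w hw := by simpa using hw
  map_target' w hw := by simpa using hw
  left_inv' w _ := by simp [mul_comm]
  right_inv' w _ := by simp [mul_comm]
  open_source := isOpen_compl_singleton
  open_target := isOpen_compl_singleton
  continuousOn_toFun := ContinuousOn.inv₀ (by fun_prop) fun w hw => by simpa using hw
  continuousOn_invFun := ContinuousOn.inv₀ (by fun_prop) fun w hw => by simpa using hw

theorem halfInv_apply (w : ℂ) : halfInv w = (2 * w)⁻¹ := rfl

theorem norm_halfInv (w : ℂ) : ‖halfInv w‖ = (2 * ‖w‖)⁻¹ := by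
  simp [halfInv_apply]

theorem halfInv_halfInv (w : ℂ) : halfInv (halfInv w) = w := by
  simp [halfInv_apply, mul_comm]

theorem hasDerivAt_halfInv {w : ℂ} (hw : w ≠ 0) :
    ∃ f', f' ≠ 0 ∧ HasDerivAt halfInv f' w := by
  have h2 : (2 : ℂ) * w ≠ 0 := by simpa using hw
  refine ⟨_, ?_, ((hasDerivAt_id w).const_mul 2).inv h2⟩
  simpa using hw

theorem hasDerivAt_mulLeft₀ (c : ℂ) (hc : c ≠ 0) (w : ℂ) :
    ∃ f', f' ≠ 0 ∧ HasDerivAt (Homeomorph.mulLeft₀ c hc).toOpenPartialHomeomorph f' w :=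
  ⟨c * 1, by simpa using hc, (hasDerivAt_id w).const_mul c⟩

theorem ne_zero_of_mem_collarAnnulus {w : ℂ} (hw : w ∈ collarAnnulus) : w ≠ 0 := by
  rintro rfl
  have := hw.1
  norm_num at this

/-- The lower bound keeps the inner collar inside the tube; the upper bound separates it from the
outer collar, where the tube coordinate has norm greater than `1`. -/
theorem norm_halfInv_lt {w : ℂ} (hw : w ∈ collarAnnulus) :
    1 / 4 < ‖halfInv w‖ ∧ ‖halfInv w‖ < 1 := by
  have h1 := hw.1
  have h2 := hw.2
  rw [norm_halfInv]
  constructor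
  · rw [one_div]
    exact inv_strictAnti₀ (by linarith) (by linarith)
  · exact inv_lt_one_of_one_lt₀ (by linarith)

section Collar

variable {S : OrientedSurface.{u}}

/-- A parametrization of an open set of a surface, composed with a map of the annulus. -/
noncomputable def collarOf (t : OpenPartialHomeomorph ℂ S.carrier)
    (ψ : OpenPartialHomeomorph ℂ ℂ) : OpenPartialHomeomorph ℂ S.carrier :=
  (ψ.trans t).restrOpen collarAnnulus isOpen_collarAnnulus

variable {t : OpenPartialHomeomorph ℂ S.carrier} {ψ : OpenPartialHomeomorph ℂ ℂ}

theorem collarOf_apply (w : ℂ) : collarOf t ψ w = t (ψ w) := rfl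

theorem collarOf_source (h : ∀ w ∈ collarAnnulus, w ∈ ψ.source ∧ ψ w ∈ t.source) :
    (collarOf t ψ).source = collarAnnulus :=
  inter_eq_right.2 h

/-- A map with nonzero derivative is cooriented with the identity, and the positivity of `t` is
pulled back along it. -/
theorem isPositive_collarOf (ht : IsPositive S t)
    (hψ : ∀ w ∈ collarAnnulus, ∃ f', f' ≠ 0 ∧ HasDerivAt ψ f' w) :
    IsPositive S (collarOf t ψ) := by
  rintro e he w ⟨⟨hw, hw'⟩, hwA⟩ hwe h0
  obtain ⟨f', hf', hf⟩ := hψ w hwA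
  refine (coorientedAt_of_hasDerivAt hf hf' ?_).trans
    (CoorientedAt.comp ψ hw (ht e he (ψ w) hw' hwe h0))
  filter_upwards [ψ.open_source.mem_nhds hw] with v hv using ψ.continuousAt hv

theorem collarOf_target_subset : (collarOf t ψ).target ⊆ t.target := by
  rw [← OpenPartialHomeomorph.image_source_eq_target]
  rintro _ ⟨w, hw, rfl⟩
  exact t.map_source hw.1.2

end Collar

section Common

variable {m n : ℕ} {D : DoodleDiagram.{u} m n} {J : Type} (C : CollaredPart D.surface J)

theorem CollaredPart.curve_mem_inner (hK : D.image ⊆ C.K)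
    (hJ : ∀ j, Disjoint (C.collar j).target D.image) (q : Fin n × Circle) :
    D.curve q ∈ C.inner := by
  refine C.mem_inner.2 ⟨hK ⟨q, rfl⟩, fun j => ?_⟩
  rintro ⟨w, hw, h⟩
  exact (hJ j).ne_of_mem ((C.collar j).map_source (C.sphere_subset_source j hw)) ⟨q, rfl⟩ h

end Common

/-! ### Surgery: capping off with disks -/

namespace RegularNeighborhoods

variable {m n : ℕ} {D : DoodleDiagram.{u} m n} {k : ℕ} {γ : SurgeryCurves D k}
  (N : RegularNeighborhoods γ)

/-- The coordinate change between a collar and the tube that contains it. -/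
noncomputable def collarMap (b : Bool) : OpenPartialHomeomorph ℂ ℂ :=
  if b then (Homeomorph.mulLeft₀ 2 two_ne_zero).toOpenPartialHomeomorph else halfInv

theorem collarMap_true (w : ℂ) : collarMap true w = 2 * w := rfl

theorem collarMap_false (w : ℂ) : collarMap false w = halfInv w := rfl

theorem norm_collarMap_true (w : ℂ) : ‖collarMap true w‖ = 2 * ‖w‖ := by
  simp [collarMap_true]

theorem collarMap_mem (i : Fin k) (b : Bool) {w : ℂ} (hw : w ∈ collarAnnulus) :
    w ∈ (collarMap b).source ∧ collarMap b w ∈ (N.tube i).source := by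
  rw [N.source_eq]
  cases b
  · have := norm_halfInv_lt hw
    exact ⟨ne_zero_of_mem_collarAnnulus hw, this.1, this.2.trans (by norm_num)⟩
  · have h1 := hw.1
    have h2 := hw.2
    refine ⟨mem_univ _, ?_⟩
    rw [mem_ofPred_eq, norm_collarMap_true]
    constructor <;> linarith

theorem exists_collarMap_eq {z : ℂ} (hz : ‖z‖ = 2 ∨ ‖z‖ = 1 / 2) :
    ∃ b w, ‖w‖ = 1 ∧ collarMap b w = z := by
  rcases hz with hz | hz
  · refine ⟨true, z / 2, by simp [hz], ?_⟩
    rw [collarMap_true]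
    ring
  · exact ⟨false, halfInv z, by simp [norm_halfInv, hz], halfInv_halfInv z⟩

theorem tube_mem_K {i : Fin k} {z : ℂ} (hz : z ∈ (N.tube i).source) :
    N.tube i z ∈ N.K ↔ ¬(1 / 2 < ‖z‖ ∧ ‖z‖ < 2) := by
  rw [K, mem_compl_iff, not_iff_not]
  constructor
  · intro h
    obtain ⟨j, w, hw, h⟩ := mem_iUnion.1 h
    have hws : w ∈ (N.tube j).source := by
      rw [N.source_eq]
      exact ⟨by linarith [hw.1], by linarith [hw.2]⟩
    obtain rfl : j = i := by
      by_contra hne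
      exact (N.disjoint_target j i hne).ne_of_mem ((N.tube j).map_source hws)
        ((N.tube i).map_source hz) h
    rwa [← (N.tube j).injOn hws hz h]
  · exact fun h => mem_iUnion.2 ⟨i, z, h, rfl⟩

/-- The complement of the removed annuli, with collars of its boundary circles. -/
noncomputable def collaredPart : CollaredPart D.surface (Fin k × Bool) where
  K := N.K
  isClosed_K := by
    refine (isOpen_iUnion fun i => ?_).isClosed_compl
    refine (N.tube i).isOpen_image_of_subset_source ?_ ?_
    · exact (isOpen_lt continuous_const continuous_norm).inter
        (isOpen_lt continuous_norm continuous_const)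
    · intro z hz
      rw [N.source_eq]
      exact ⟨by linarith [hz.1], by linarith [hz.2]⟩
  collar j := collarOf (N.tube j.1) (collarMap j.2)
  source_eq j := collarOf_source fun w hw => N.collarMap_mem j.1 j.2 hw
  positive j := by
    refine isPositive_collarOf (N.positive j.1) fun w hw => ?_
    rcases j with ⟨i, _ | _⟩
    · exact hasDerivAt_halfInv (ne_zero_of_mem_collarAnnulus hw)
    · exact hasDerivAt_mulLeft₀ _ two_ne_zero w
  disjoint_target := by
    have key : ∀ i, Disjoint (collarOf (N.tube i) (collarMap true)).target
        (collarOf (N.tube i) (collarMap false)).target := by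
      intro i
      rw [← OpenPartialHomeomorph.image_source_eq_target,
        ← OpenPartialHomeomorph.image_source_eq_target,
        collarOf_source fun w hw => N.collarMap_mem i true hw,
        collarOf_source fun w hw => N.collarMap_mem i false hw, disjoint_left]
      rintro _ ⟨v, hv, rfl⟩ ⟨w, hw, h⟩
      have h1 := (N.tube i).injOn (N.collarMap_mem i false hw).2 (N.collarMap_mem i true hv).2 h
      have h2 := (norm_halfInv_lt hw).2
      have h3 := norm_collarMap_true v
      rw [← h1, collarMap_false] at h3
      linarith [hv.1]
    rintro ⟨i, b⟩ ⟨j, c⟩ hne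
    by_cases hij : i = j
    · subst hij
      cases b <;> cases c
      · exact absurd rfl hne
      · exact (key i).symm
      · exact key i
      · exact absurd rfl hne
    · exact (N.disjoint_target i j hij).mono collarOf_target_subset collarOf_target_subset
  disjoint_boundary j := (N.disjoint_boundary j.1).mono_left collarOf_target_subset
  mem_K_iff := by
    rintro ⟨i, b⟩ w hw
    rw [collarOf_source fun w hw => N.collarMap_mem i b hw] at hw
    rw [collarOf_apply, N.tube_mem_K (N.collarMap_mem i b hw).2]
    have h1 := hw.1
    have h2 := hw.2
    cases b
    · rw [collarMap_false, norm_halfInv, one_div,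
        inv_lt_inv₀ (by norm_num) (by linarith), not_and_or, not_lt, not_lt]
      have h3 := (norm_halfInv_lt hw).2
      rw [norm_halfInv] at h3
      constructor
      · rintro (h | h) <;> linarith
      · exact fun h => Or.inl (by linarith)
    · rw [norm_collarMap_true, not_and_or, not_lt, not_lt]
      constructor
      · rintro (h | h) <;> linarith
      · exact fun h => Or.inr (by linarith)
  isOpen_diff := by
    have hsub : ∀ i, {z : ℂ | 1 / 2 ≤ ‖z‖ ∧ ‖z‖ ≤ 2} ⊆ (N.tube i).source := fun i z hz => by
      rw [N.source_eq]
      exact ⟨by linarith [hz.1], by linarith [hz.2]⟩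
    have hcpt : IsCompact {z : ℂ | 1 / 2 ≤ ‖z‖ ∧ ‖z‖ ≤ 2} := by
      have : {z : ℂ | 1 / 2 ≤ ‖z‖ ∧ ‖z‖ ≤ 2} = Metric.closedBall 0 2 ∩ {z | 1 / 2 ≤ ‖z‖} := by
        ext z
        simp [and_comm]
      rw [this]
      exact (isCompact_closedBall _ _).inter_right (isClosed_le continuous_const continuous_norm)
    -- Removing the bounding circles as well amounts to removing the closed annuli, which are
    -- compact.
    have : N.K \ ⋃ j : Fin k × Bool,
        collarOf (N.tube j.1) (collarMap j.2) '' Metric.sphere 0 1 =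
          (⋃ i, N.tube i '' {z | 1 / 2 ≤ ‖z‖ ∧ ‖z‖ ≤ 2})ᶜ := by
      rw [K, sdiff_eq, ← compl_union]
      congr 1
      refine Subset.antisymm (union_subset ?_ ?_) ?_
      · exact iUnion_mono fun i => image_mono fun z hz => ⟨hz.1.le, hz.2.le⟩
      · refine iUnion_subset ?_
        rintro ⟨i, b⟩ _ ⟨w, hw, rfl⟩
        rw [mem_sphere_zero_iff_norm] at hw
        refine mem_iUnion.2 ⟨i, collarMap b w, ?_, rfl⟩
        cases b
        · rw [mem_ofPred_eq, collarMap_false, norm_halfInv, hw]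
          norm_num
        · rw [mem_ofPred_eq, norm_collarMap_true, hw]
          norm_num
      · refine iUnion_subset fun i => ?_
        rintro _ ⟨z, hz, rfl⟩
        by_cases h : 1 / 2 < ‖z‖ ∧ ‖z‖ < 2
        · exact Or.inl (mem_iUnion.2 ⟨i, z, h, rfl⟩)
        · obtain ⟨b, w, hw, rfl⟩ := exists_collarMap_eq (z := z) (by
            rw [not_and_or, not_lt, not_lt] at h
            exact h.symm.imp (fun h => le_antisymm hz.2 h) fun h => le_antisymm h hz.1)
          exact Or.inr (mem_iUnion.2 ⟨(i, b), w, mem_sphere_zero_iff_norm.2 hw, rfl⟩)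
    rw [this]
    exact (isCompact_iUnion fun i =>
      hcpt.image_of_continuousOn ((N.tube i).continuousOn.mono (hsub i))).isClosed.isOpen_compl

theorem curve_mem_inner (q : Fin n × Circle) : D.curve q ∈ N.collaredPart.inner := by
  refine N.collaredPart.curve_mem_inner ?_ (fun j => ?_) q
  · intro x hx h
    obtain ⟨i, z, hz, h⟩ := mem_iUnion.1 h
    refine (N.disjoint_image i).ne_of_mem ((N.tube i).map_source ?_) hx h
    rw [N.source_eq]
    exact ⟨by linarith [hz.1], by linarith [hz.2]⟩
  · exact (N.disjoint_image j.1).mono_left collarOf_target_subset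

/-- The disks that are glued in a surgery. -/
noncomputable def filling : Filling N.collaredPart (Disks k) (Fin k × Bool) where
  piece p := (p.1, p.2.1)
  collarPiece := id
  isClopen_piece f := (isClopen_discrete {f}).preimage (by fun_prop)
  rim := {p | ‖(p.2.2 : ℂ)‖ = 1}
  attach p := N.tube p.1 ((if p.2.1 then 2 else 1 / 2) * (p.2.2 : ℂ))
  -- At the inner circle the collar is `w ↦ 1 / (2w)`, which on `‖w‖ = 1` equals `conj w / 2`. As
  -- `d` is glued to `d / 2`, its collar coordinate is `conj d`.
  β p := if p.2.1 then p.2.2 else (starRingEnd ℂ) p.2.2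
  continuous_β := by
    refine continuous_prod_of_discrete_left.2 fun i => continuous_prod_of_discrete_left.2 fun b => ?_
    cases b
    · exact Complex.continuous_conj.comp continuous_subtype_val
    · exact continuous_subtype_val
  trans _ := id
  trans_deriv _ w _ := ⟨1, one_ne_zero, hasDerivAt_id w⟩
  attach_rim := by
    rintro ⟨i, b, d⟩ hd
    change ‖(d : ℂ)‖ = 1 at hd
    cases b
    · refine ⟨(i, false), (starRingEnd ℂ) d, rfl, by simpa using hd, ?_, rfl⟩
      change _ = N.tube i (halfInv _)
      rw [halfInv_apply, ← Complex.inv_eq_conj hd]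
      simp [mul_comm]
    · exact ⟨(i, true), d, rfl, hd, rfl, rfl⟩
  trans_inj i j v w hij _ _ _ _ h := ⟨hij, h⟩
  trans_ne := by
    rintro j w ⟨i, b, d⟩ hd - hw - h
    have h1 : ‖w‖ = ‖(d : ℂ)‖ := by
      rw [← id_eq w, h]
      cases b <;> simp
    exact hd (le_antisymm (mem_closedBall_zero_iff.1 d.2) (h1 ▸ hw))
  β_inj := by
    rintro ⟨i, b, d⟩ - ⟨i', b', d'⟩ - hp h
    obtain ⟨rfl, rfl⟩ := Prod.mk.inj hp
    have : d = d' := by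
      apply Subtype.ext
      cases b
      · exact (starRingEnd ℂ).injective h
      · exact h
    rw [this]
  A := Metric.ball 0 2
  isOpen_A := Metric.isOpen_ball
  A_subset := Subset.rfl
  trans_mem _ w _ hw := mem_ball_zero_iff.2 hw
  β_mem := by
    rintro ⟨i, b, d⟩
    have := mem_closedBall_zero_iff.1 d.2
    cases b <;> simp <;> linarith
  surj := by
    rintro ⟨i, b⟩ z hz
    rw [mem_ball_zero_iff] at hz
    -- The midpoint of `‖z‖` and `2` bounds the norm near `z`.
    refine ⟨(‖z‖ + 2) / 2, by linarith, ?_⟩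
    have h : ∀ᶠ y in 𝓝 z, ‖y‖ < (‖z‖ + 2) / 2 :=
      continuous_norm.continuousAt.eventually_lt_const (by linarith)
    filter_upwards [h] with y hy
    rcases le_total ‖y‖ 1 with h1 | h1
    · left
      cases b
      · exact ⟨(i, false, ⟨(starRingEnd ℂ) y, by simpa using h1⟩), rfl, by simp⟩
      · exact ⟨(i, true, ⟨y, by simpa using h1⟩), rfl, by simp⟩
    · exact Or.inr ⟨(i, b), y, rfl, h1, hy.le, rfl⟩
  core := Metric.ball 0 (3 / 2)
  isOpen_core := Metric.isOpen_ball
  β_mem_core := by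
    rintro ⟨i, b, d⟩
    have := mem_closedBall_zero_iff.1 d.2
    cases b <;> simp <;> linarith
  trans_mem_core _ w hw := by
    rw [mem_ball_zero_iff, id, hw]
    norm_num
  norm_le_of_mem_core _ w _ _ h := (mem_ball_zero_iff.1 h).le

theorem isGlue : N.filling.IsGlue N.glue := by
  intro p q
  constructor
  · rintro ⟨x, i, b, d, hp, hq, hd, hx⟩
    exact ⟨x, (i, b, d), hp, hq, hd, hx⟩
  · rintro ⟨x, ⟨i, b, d⟩, hp, hq, hd, hx⟩
    exact ⟨x, i, b, d, hp, hq, hd, hx⟩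

theorem exists_isSurgery : ∃ E : DoodleDiagram.{u} m n, N.IsSurgery E :=
  N.filling.exists_isResult N.isGlue N.curve_mem_inner

theorem stablyEquivalent_of_isSurgery {E : DoodleDiagram.{u} m n} (hE : N.IsSurgery E) :
    StablyEquivalent E D :=
  (N.collaredPart.stablyEquivalent_of_isResult (Q := Quot N.glue) (ι := N.incl) N.curve_mem_inner
    (Filling.continuous_ofK (C := N.collaredPart)) (N.filling.ofK_injective N.isGlue) hE).2

end RegularNeighborhoods

/-! ### Handle addition: gluing annuli -/

namespace HandleDisks

variable {m n : ℕ} {D : DoodleDiagram.{u} m n} {k : ℕ} (H : HandleDisks D k)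

theorem mem_disk_source {i : Fin k × Bool} {w : ℂ} : w ∈ (H.disk i).source ↔ ‖w‖ < 2 := by
  rw [H.source_eq, mem_ball_zero_iff]

theorem collar_mem (i : Fin k × Bool) {w : ℂ} (hw : w ∈ collarAnnulus) :
    w ∈ (OpenPartialHomeomorph.refl ℂ).source ∧
      OpenPartialHomeomorph.refl ℂ w ∈ (H.disk i).source :=
  ⟨mem_univ _, H.mem_disk_source.2 hw.2⟩

/-- The complement of the interiors of the disks, with collars of its boundary circles. -/
noncomputable def collaredPart : CollaredPart D.surface (Fin k × Bool) where
  K := H.K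
  isClosed_K := by
    refine (isOpen_iUnion fun i => ?_).isClosed_compl
    refine (H.disk i).isOpen_image_of_subset_source Metric.isOpen_ball ?_
    rw [H.source_eq]
    exact Metric.ball_subset_ball one_le_two
  collar j := collarOf (H.disk j) (.refl ℂ)
  source_eq j := collarOf_source fun _ hw => H.collar_mem j hw
  positive j := isPositive_collarOf (H.positive j) fun w _ => ⟨1, one_ne_zero, hasDerivAt_id w⟩
  disjoint_target i j hij :=
    (H.disjoint_target i j hij).mono collarOf_target_subset collarOf_target_subset
  disjoint_boundary j := (H.disjoint_boundary j).mono_left collarOf_target_subset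
  mem_K_iff := by
    intro i w hw
    rw [collarOf_source fun w hw => H.collar_mem i hw] at hw
    change H.disk i w ∈ (_)ᶜ ↔ _
    rw [mem_compl_iff, ← not_lt, not_iff_not]
    constructor
    · intro h
      obtain ⟨j, v, hv, h⟩ := mem_iUnion.1 h
      rw [mem_ball_zero_iff] at hv
      have hvs : v ∈ (H.disk j).source := H.mem_disk_source.2 (hv.trans one_lt_two)
      have hws : w ∈ (H.disk i).source := H.mem_disk_source.2 hw.2
      obtain rfl : j = i := by
        by_contra hne
        exact (H.disjoint_target j i hne).ne_of_mem ((H.disk j).map_source hvs)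
          ((H.disk i).map_source hws) h
      rwa [← (H.disk j).injOn hvs hws h]
    · exact fun h => mem_iUnion.2 ⟨i, w, mem_ball_zero_iff.2 h, rfl⟩
  isOpen_diff := by
    have : H.K \ ⋃ j, collarOf (H.disk j) (.refl ℂ) '' Metric.sphere 0 1 =
        (⋃ i, H.disk i '' Metric.closedBall 0 1)ᶜ := by
      rw [K, sdiff_eq, ← compl_union, ← iUnion_union_distrib]
      congr 2
      funext i
      rw [← Metric.ball_union_sphere, image_union]
      rfl
    rw [this]
    refine (isCompact_iUnion fun i => (isCompact_closedBall _ _).image_of_continuousOn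
      ((H.disk i).continuousOn.mono ?_)).isClosed.isOpen_compl
    rw [H.source_eq]
    exact Metric.closedBall_subset_ball one_lt_two

theorem curve_mem_inner (q : Fin n × Circle) : D.curve q ∈ H.collaredPart.inner := by
  refine H.collaredPart.curve_mem_inner ?_ (fun j => ?_) q
  · intro x hx h
    obtain ⟨i, z, hz, h⟩ := mem_iUnion.1 h
    rw [mem_ball_zero_iff] at hz
    exact (H.disjoint_image i).ne_of_mem
      ((H.disk i).map_source (H.mem_disk_source.2 (hz.trans one_lt_two))) hx h
  · exact (H.disjoint_image j).mono_left collarOf_target_subset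

/-- The coordinate change between a collar and the annulus that contains a handle. -/
noncomputable def handleMap (b : Bool) : ℂ → ℂ := if b then id else halfInv

/-- The coordinate of a handle in the annulus that contains it. -/
noncomputable def handleCoord (p : Handles k) : ℂ := (((1 + p.2.2) / 2 : ℝ) : ℂ) * (p.2.1 : ℂ)

theorem norm_handleCoord (p : Handles k) : ‖handleCoord p‖ = (1 + p.2.2) / 2 := by
  have := p.2.2.2.1
  rw [handleCoord, norm_mul, Circle.norm_coe, mul_one, Complex.norm_of_nonneg (by linarith)]

theorem norm_handleMap_false {w : ℂ} (hw : 1 ≤ ‖w‖) (hw' : ‖w‖ < 2) :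
    1 / 4 < ‖handleMap false w‖ ∧ ‖handleMap false w‖ ≤ 1 / 2 := by
  change _ < ‖halfInv w‖ ∧ ‖halfInv w‖ ≤ _
  refine ⟨(norm_halfInv_lt ⟨by linarith, hw'⟩).1, ?_⟩
  rw [norm_halfInv, one_div]
  exact inv_anti₀ two_pos (by linarith)

/-- The handles that are glued in an addition of handles. -/
noncomputable def filling : Filling H.collaredPart (Handles k) (Fin k) where
  piece p := p.1
  collarPiece j := j.1
  isClopen_piece f := (isClopen_discrete {f}).preimage continuous_fst
  rim := {p | p.2.2 = 0 ∨ p.2.2 = 1}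
  attach p := open Classical in
    if p.2.2 = 1 then H.disk (p.1, true) p.2.1 else H.disk (p.1, false) ((p.2.1⁻¹ : Circle) : ℂ)
  β := handleCoord
  continuous_β := by
    unfold handleCoord
    fun_prop
  -- The handle fills `1/2 ≤ ‖z‖ ≤ 1`, the collar of `γᵢ⁺` fills `1 ≤ ‖z‖ < 2`, and `w ↦ 1 / (2w)`
  -- sends the collar of `γᵢ⁻` to `1/4 < ‖z‖ ≤ 1/2`. It maps `v⁻¹` to `v / 2`, so the inversion in
  -- the gluing is what makes this coordinate holomorphic.
  trans j := handleMap j.2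
  trans_deriv := by
    rintro ⟨i, _ | _⟩ w hw
    · exact hasDerivAt_halfInv (ne_zero_of_mem_collarAnnulus hw.2)
    · exact ⟨1, one_ne_zero, hasDerivAt_id w⟩
  attach_rim := by
    rintro ⟨i, v, t⟩ (ht | ht)
    · obtain rfl : t = 0 := ht
      refine ⟨(i, false), (v⁻¹ : Circle), rfl, Circle.norm_coe _, if_neg zero_ne_one, ?_⟩
      change handleCoord _ = halfInv _
      simp [handleCoord, halfInv_apply, mul_comm]
    · obtain rfl : t = 1 := ht
      refine ⟨(i, true), v, rfl, Circle.norm_coe _, if_pos rfl, ?_⟩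
      change handleCoord _ = (v : ℂ)
      simp [handleCoord]
  trans_inj := by
    rintro ⟨i, b⟩ ⟨j, c⟩ v w hij hv hv' hw hw' h
    obtain rfl : i = j := hij
    cases b <;> cases c
    · exact ⟨rfl, by rw [← halfInv_halfInv v, ← halfInv_halfInv w]; exact congrArg halfInv h⟩
    · have h1 := (norm_handleMap_false hv hv').2
      have h2 : handleMap false v = w := h
      rw [h2] at h1
      linarith
    · have h1 := (norm_handleMap_false hw hw').2
      have h2 : v = handleMap false w := h
      rw [← h2] at h1
      linarith
    · exact ⟨rfl, h⟩
  trans_ne := by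
    rintro ⟨i, b⟩ w ⟨j, v, t⟩ hp - hw hw' h
    rw [mem_ofPred_eq, not_or] at hp
    have h0 : 0 < (t : ℝ) := lt_of_le_of_ne t.2.1 fun h => hp.1 (Subtype.ext h.symm)
    have h1 : (t : ℝ) < 1 := lt_of_le_of_ne t.2.2 fun h => hp.2 (Subtype.ext h)
    have h2 := norm_handleCoord (j, v, t)
    rw [← h] at h2
    cases b
    · have := (norm_handleMap_false hw hw').2
      simp only at h2
      linarith
    · have h3 : ‖w‖ = (1 + (t : ℝ)) / 2 := h2
      linarith
  β_inj := by
    rintro ⟨i, v, t⟩ - ⟨i', v', t'⟩ - hi h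
    obtain rfl : i = i' := hi
    have h1 := norm_handleCoord (i, v, t)
    rw [h, norm_handleCoord] at h1
    have ht : t' = t := Subtype.ext (by simp only at h1; linarith)
    subst ht
    have h0 : (((1 + (t' : ℝ)) / 2 : ℝ) : ℂ) ≠ 0 := by
      have := t'.2.1
      exact Complex.ofReal_ne_zero.2 (by linarith)
    obtain rfl : v = v' := Circle.ext (mul_left_cancel₀ h0 h)
    rfl
  A := {z | 1 / 4 < ‖z‖ ∧ ‖z‖ < 2}
  isOpen_A := (isOpen_lt continuous_const continuous_norm).inter
    (isOpen_lt continuous_norm continuous_const)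
  A_subset z hz := mem_ball_zero_iff.2 hz.2
  trans_mem := by
    rintro ⟨i, _ | _⟩ w hw hw'
    · have := norm_handleMap_false hw hw'
      exact ⟨this.1, this.2.trans_lt (by norm_num)⟩
    · exact ⟨lt_of_lt_of_le (by norm_num) hw, hw'⟩
  β_mem p := by
    have h0 := p.2.2.2.1
    have h1 := p.2.2.2.2
    rw [mem_ofPred_eq, norm_handleCoord]
    constructor <;> linarith
  surj := by
    rintro i z ⟨hz, hz'⟩
    have hm : 1 / 4 < (‖z‖ + 1 / 4) / 2 := by linarith
    -- The first bound is for the outer collar. The second is for the inner one, where `‖w‖ = 1 /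
    -- (2‖y‖)` and `‖y‖` stays above the midpoint of `1/4` and `‖z‖`.
    refine ⟨max ((‖z‖ + 2) / 2) (2 * ((‖z‖ + 1 / 4) / 2))⁻¹, max_lt (by linarith) ?_, ?_⟩
    · rw [inv_lt_comm₀ (by linarith) two_pos]
      linarith
    have h1 : ∀ᶠ y in 𝓝 z, ‖y‖ < (‖z‖ + 2) / 2 :=
      continuous_norm.continuousAt.eventually_lt_const (by linarith)
    have h2 : ∀ᶠ y in 𝓝 z, (‖z‖ + 1 / 4) / 2 < ‖y‖ :=
      continuous_norm.continuousAt.eventually_const_lt (by linarith)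
    filter_upwards [h1, h2] with y hy hy'
    rcases le_total 1 ‖y‖ with h | h
    · exact Or.inr ⟨(i, true), y, rfl, h, le_max_of_le_left hy.le, rfl⟩
    rcases le_total ‖y‖ (1 / 2) with h' | h'
    · refine Or.inr ⟨(i, false), halfInv y, rfl, ?_, le_max_of_le_right ?_, halfInv_halfInv y⟩
      · rw [norm_halfInv]
        exact (one_le_inv₀ (by linarith)).2 (by linarith)
      · rw [norm_halfInv]
        exact inv_anti₀ (by linarith) (by linarith)
    · left
      have hy0 : (‖y‖ : ℂ) ≠ 0 := Complex.ofReal_ne_zero.2 (by linarith)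
      have hv : ‖y / ‖y‖‖ = 1 := by
        rw [norm_div, Complex.norm_real, norm_norm, div_self (by linarith)]
      -- The height `2‖y‖ - 1` solves `(1 + t) / 2 = ‖y‖`.
      refine ⟨(i, ⟨y / ‖y‖, mem_sphere_zero_iff_norm.2 hv⟩,
        ⟨2 * ‖y‖ - 1, by linarith, by linarith⟩), rfl, ?_⟩
      change (((1 + (2 * ‖y‖ - 1)) / 2 : ℝ) : ℂ) * (y / ‖y‖) = y
      push_cast
      field_simp
      ring
  -- On the inner collar `1 / (2‖w‖) > 1 / 3` says exactly `‖w‖ < 3 / 2`.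
  core := {z | 1 / 3 < ‖z‖ ∧ ‖z‖ < 3 / 2}
  isOpen_core := (isOpen_lt continuous_const continuous_norm).inter
    (isOpen_lt continuous_norm continuous_const)
  β_mem_core p := by
    have h0 := p.2.2.2.1
    have h1 := p.2.2.2.2
    rw [mem_ofPred_eq, norm_handleCoord]
    constructor <;> linarith
  trans_mem_core := by
    rintro ⟨i, _ | _⟩ w hw
    · change 1 / 3 < ‖halfInv w‖ ∧ ‖halfInv w‖ < 3 / 2
      rw [norm_halfInv, hw]
      norm_num
    · change 1 / 3 < ‖w‖ ∧ ‖w‖ < 3 / 2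
      rw [hw]
      norm_num
  norm_le_of_mem_core := by
    rintro ⟨i, _ | _⟩ w hw hw' ⟨h, h'⟩
    · change 1 / 3 < ‖halfInv w‖ at h
      rw [norm_halfInv, one_div, inv_lt_inv₀ (by norm_num) (by linarith)] at h
      linarith
    · exact le_of_lt h'

theorem isGlue : H.filling.IsGlue H.glue := by
  have h1 (i : Fin k) (v : Circle) : H.filling.attach (i, v, 1) = H.disk (i, true) v := if_pos rfl
  have h0 (i : Fin k) (v : Circle) :
      H.filling.attach (i, v, 0) = H.disk (i, false) ((v⁻¹ : Circle) : ℂ) := if_neg zero_ne_one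
  intro p q
  constructor
  · rintro ⟨x, i, v, hp, ⟨hq, hx⟩ | ⟨hq, hx⟩⟩
    · exact ⟨x, _, hp, hq, Or.inr rfl, hx.trans (h1 i v).symm⟩
    · exact ⟨x, _, hp, hq, Or.inl rfl, hx.trans (h0 i v).symm⟩
  · rintro ⟨x, ⟨i, v, t⟩, hp, hq, ht, hx⟩
    rcases ht with ht | ht
    · obtain rfl : t = 0 := ht
      exact ⟨x, i, v, hp, Or.inr ⟨hq, hx.trans (h0 i v)⟩⟩
    · obtain rfl : t = 1 := ht
      exact ⟨x, i, v, hp, Or.inl ⟨hq, hx.trans (h1 i v)⟩⟩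

theorem exists_isHandleAddition : ∃ E : DoodleDiagram.{u} m n, H.IsHandleAddition E :=
  H.filling.exists_isResult H.isGlue H.curve_mem_inner

theorem stablyEquivalent_of_isHandleAddition {E : DoodleDiagram.{u} m n}
    (hE : H.IsHandleAddition E) : StablyEquivalent D E :=
  (H.collaredPart.stablyEquivalent_of_isResult (Q := Quot H.glue) (ι := H.incl) H.curve_mem_inner
    (Filling.continuous_ofK (C := H.collaredPart)) (H.filling.ofK_injective H.isGlue) hE).1

end HandleDisks

end Doodle

theorem mainTheorem9 {m n : ℕ} (D : Doodle.DoodleDiagram.{u} m n) :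
    (∀ (k : ℕ) (γ : Doodle.SurgeryCurves D k) (N : Doodle.RegularNeighborhoods γ),
      (∃ E : Doodle.DoodleDiagram.{u} m n, N.IsSurgery E) ∧
      ∀ E : Doodle.DoodleDiagram.{u} m n, N.IsSurgery E → Doodle.StablyEquivalent E D) ∧
    (∀ (k : ℕ) (H : Doodle.HandleDisks D k),
      (∃ E : Doodle.DoodleDiagram.{u} m n, H.IsHandleAddition E) ∧
      ∀ E : Doodle.DoodleDiagram.{u} m n, H.IsHandleAddition E → Doodle.StablyEquivalent D E) :=
  ⟨fun _ _ N => ⟨N.exists_isSurgery, fun _ => N.stablyEquivalent_of_isSurgery⟩,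
    fun _ H => ⟨H.exists_isHandleAddition, fun _ => H.stablyEquivalent_of_isHandleAddition⟩⟩
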